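/- Let $\Omega\Subset\mathbb C^n$ be a bounded strictly pseudoconvex domain with smooth boundary: $\Omega=\{z\in U:\rho(z)<0\}$ for some open $U\supset\overline\Omega$ and some smooth $\rho:U\to\mathbb R$ with $dd^c\rho>0$ on $U$ and $d\rho\neq0$ on $\partial\Omega$, where $dd^c=\frac i\pi\partial\bar\partial$. Let $$\mathcal H=\{\varphi\in C^\infty(\overline\Omega,\mathbb R):\ dd^c\varphi>0\text{ on }\overline\Omega,\ \varphi=0\text{ on }\partial\Omega\},\qquad T_\varphi\mathcal H=\{\xi\in C^\infty(\overline\Omega,\mathbb R):\ \xi=0\text{ on }\partial\Omega\}.$$ Here $C^\infty$ up to the boundary means smooth on a neighbourhood. For $\varphi\in\mathcal H$ let $\varphi_{\alpha\bar\beta}=\partial^2\varphi/\partial z_\alpha\partial\bar z_\beta$ and let $(\varphi^{\alpha\bar\beta})$ be its inverse, $\sum_\beta\varphi^{\alpha\bar\beta}\varphi_{\gamma\bar\beta}=\delta_{\alpha\gamma}$. For real functions $f,g$ put $$\langle\nabla f,\nabla g\rangle_\varphi=\operatorname{Re}\sum_{\alpha,\beta}\varphi^{\alpha\bar\beta}\frac{\partial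 f}{\partial z_\alpha}\frac{\partial g}{\partial\bar z_\beta},\qquad \{f,g\}_\varphi=\frac i2\sum_{\alpha,\beta}\varphi^{\alpha\bar\beta}\Big(\frac{\partial f}{\partial\bar z_\beta}\frac{\partial g}{\partial z_\alpha}-\frac{\partial f}{\partial z_\alpha}\frac{\partial g}{\partial\bar z_\beta}\Big).$$ The Mabuchi metric is $\langle\langle f,g\rangle\rangle_\varphi=\int_\Omega fg\,(dd^c\varphi)^n$, with norm $\|f\|_\varphi=\langle\langle f,f\rangle\rangle_\varphi^{1/2}$, and its covariant derivative of a vector field $\psi$ along a path $\varphi(t)$ is $D\psi=\frac{d\psi}{dt}-\langle\nabla\psi,\nabla\dot\varphi\rangle_\varphi$. Let $T\subset\mathbb R^2$ be open, let $\varphi(t,s)\in\mathcal H$ for $(t,s)\in T$ be a two-parameter family, smooth on $T\times\overline\Omega$ (that is, on an open neighbourhood of this set), and write $\varphi_t=\partial\varphi/\partial t$, $\varphi_s=\partial\varphi/\partial s$. Let $D_t,D_s$ denote the covariant derivatives along $t\mapsto\varphi(t,s)$ and $s\mapsto\varphi(t,s)$. For a vector field $\psi$ along $\varphi$ put $$R_\varphi(\varphi_t,\varphi_s)\psi:=D_sD_t\psi-D_tD_s\psi,\qquad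 K_\varphi(\varphi_t,\varphi_s):=\langle\langle R_\varphi(\varphi_t,\varphi_s)\varphi_t,\varphi_s\rangle\rangle_\varphi,$$ the curvature tensor and the (unnormalised) sectional curvature. Then, for every $\psi(t,s)\in T_{\varphi(t,s)}\mathcal H$ smooth on $T\times\overline\Omega$ in the same sense, at every $(t,s)\in T$ and on $\overline\Omega$, $$R_\varphi(\varphi_t,\varphi_s)\psi=-\{\{\varphi_t,\varphi_s\}_\varphi,\psi\}_\varphi .$$ Moreover, at every $(t,s)\in T$, $$K_\varphi(\varphi_t,\varphi_s)=-\big\|\{\varphi_t,\varphi_s\}_\varphi\big\|_\varphi^2\le0 .$$ -/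

import Mathlib

open scoped ContDiff ComplexOrder

noncomputable section

/-- The Wirtinger derivative `∂F/∂z_α = (1/2)(∂F/∂x_α - i ∂F/∂y_α)` on `ℂⁿ`. -/
def wirtinger {n : ℕ} (α : Fin n) (F : (Fin n → ℂ) → ℂ) (z : Fin n → ℂ) : ℂ :=
  (1 / 2) * (fderiv ℝ F z (Pi.single α 1) - Complex.I * fderiv ℝ F z (Pi.single α Complex.I))

/-- The Wirtinger derivative `∂F/∂z̄_α = (1/2)(∂F/∂x_α + i ∂F/∂y_α)` on `ℂⁿ`. -/
def wirtingerBar {n : ℕ} (α : Fin n) (F : (Fin n → ℂ) → ℂ) (z : Fin n → ℂ) : ℂ :=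
  (1 / 2) * (fderiv ℝ F z (Pi.single α 1) + Complex.I * fderiv ℝ F z (Pi.single α Complex.I))

/-- `∂f/∂z_α` for a real-valued function `f`. -/
def dz {n : ℕ} (α : Fin n) (f : (Fin n → ℂ) → ℝ) (z : Fin n → ℂ) : ℂ :=
  wirtinger α (fun w => (f w : ℂ)) z

/-- `∂f/∂z̄_α` for a real-valued function `f`. -/
def dzBar {n : ℕ} (α : Fin n) (f : (Fin n → ℂ) → ℝ) (z : Fin n → ℂ) : ℂ :=
  wirtingerBar α (fun w => (f w : ℂ)) z

/-- The matrix `φ_{αβ̄} = ∂²φ/∂z_α∂z̄_β`. With `dd^c = (i/π)∂∂̄` one has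
`dd^c φ = (i/π) ∑ φ_{αβ̄} dz_α ∧ dz̄_β`, so `dd^c φ > 0` at `z` means that this matrix is
positive definite at `z`. -/
def complexHessian {n : ℕ} (φ : (Fin n → ℂ) → ℝ) (z : Fin n → ℂ) : Matrix (Fin n) (Fin n) ℂ :=
  Matrix.of fun α β => wirtinger α (dzBar β φ) z

/-- The inverse `φ^{αβ̄}`, with the usual index convention `∑_β φ^{αβ̄} φ_{γβ̄} = δ_{αγ}`. -/
def inverseHessian {n : ℕ} (φ : (Fin n → ℂ) → ℝ) (z : Fin n → ℂ) : Matrix (Fin n) (Fin n) ℂ :=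
  ((complexHessian φ z).transpose)⁻¹

/-- The real scalar product of gradients `⟨∇f, ∇g⟩_φ = Re ∑ φ^{αβ̄} f_α g_β̄`, i.e. the symmetric
bilinear form with `|∇f|²_φ = ∑ φ^{αβ̄} f_α f_β̄`. -/
def gradInner {n : ℕ} (φ f g : (Fin n → ℂ) → ℝ) (z : Fin n → ℂ) : ℝ :=
  (∑ α, ∑ β, inverseHessian φ z α β * (dz α f z * dzBar β g z)).re

/-- The Poisson bracket `{f, g}_φ = (i/2) ∑ φ^{αβ̄} (f_β̄ g_α - f_α g_β̄)` of the Kähler form of the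
metric whose gradients enter `gradInner`. For real `f`, `g` and Hermitian `φ_{αβ̄}` the sum
is a real number; `.re` only changes its type. -/
def poissonBracket {n : ℕ} (φ f g : (Fin n → ℂ) → ℝ) (z : Fin n → ℂ) : ℝ :=
  (Complex.I / 2 * ∑ α, ∑ β, inverseHessian φ z α β *
    (dzBar β f z * dz α g z - dz α f z * dzBar β g z)).re

/-- The density of `(dd^c φ)^n = n! (2/π)^n det(φ_{αβ̄}) dV` with respect to Lebesgue measure. -/
def mongeAmpereDensity {n : ℕ} (φ : (Fin n → ℂ) → ℝ) (z : Fin n → ℂ) : ℝ :=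
  (n.factorial : ℝ) * (2 / Real.pi) ^ n * (complexHessian φ z).det.re

/-- `Ω` is a bounded strictly pseudoconvex domain with smooth boundary in `ℂⁿ`. -/
structure IsSmoothStrictlyPseudoconvexDomain {n : ℕ} (Ω : Set (Fin n → ℂ)) : Prop where
  isOpen : IsOpen Ω
  isConnected : IsConnected Ω
  isBounded : Bornology.IsBounded Ω
  exists_defining : ∃ (U : Set (Fin n → ℂ)) (ρ : (Fin n → ℂ) → ℝ),
    IsOpen U ∧ closure Ω ⊆ U ∧ ContDiffOn ℝ ∞ ρ U ∧ Ω = {z ∈ U | ρ z < 0} ∧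
    (∀ z ∈ U, (complexHessian ρ z).PosDef) ∧ ∀ z ∈ frontier Ω, fderiv ℝ ρ z ≠ 0

/-- `f ∈ C^∞(Ω̄, ℝ)`: `f` is smooth on an open neighbourhood of `Ω̄`. (The values of `f` away from
`Ω̄` play no role.) -/
def SmoothUpToBoundary {n : ℕ} (Ω : Set (Fin n → ℂ)) (f : (Fin n → ℂ) → ℝ) : Prop :=
  ∃ W : Set (Fin n → ℂ), IsOpen W ∧ closure Ω ⊆ W ∧ ContDiffOn ℝ ∞ f W

/-- The Mabuchi space `H` of smooth strictly plurisubharmonic functions on `Ω̄` vanishing on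
`∂Ω`. -/
def mabuchiSpace {n : ℕ} (Ω : Set (Fin n → ℂ)) : Set ((Fin n → ℂ) → ℝ) :=
  {φ | SmoothUpToBoundary Ω φ ∧ (∀ z ∈ closure Ω, (complexHessian φ z).PosDef) ∧
    ∀ z ∈ frontier Ω, φ z = 0}

/-- The tangent space of `H` (the same at every point): smooth functions on `Ω̄` vanishing on
`∂Ω`. -/
def mabuchiTangent {n : ℕ} (Ω : Set (Fin n → ℂ)) : Set ((Fin n → ℂ) → ℝ) :=
  {ξ | SmoothUpToBoundary Ω ξ ∧ ∀ z ∈ frontier Ω, ξ z = 0}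

/-- A two-parameter family of functions, with parameters in `T`, that is smooth in all variables
`(t, s, z)` on `T × Ω̄`, i.e. on an open neighbourhood of `T × Ω̄`. -/
def IsSmoothFamily {n : ℕ} (Ω : Set (Fin n → ℂ)) (T : Set (ℝ × ℝ))
    (φ : ℝ → ℝ → (Fin n → ℂ) → ℝ) : Prop :=
  ∃ W : Set ((ℝ × ℝ) × (Fin n → ℂ)), IsOpen W ∧ T ×ˢ closure Ω ⊆ W ∧
    ContDiffOn ℝ ∞ (fun q : (ℝ × ℝ) × (Fin n → ℂ) => φ q.1.1 q.1.2 q.2) W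

/-- The velocity `dγ/dt` of a path of functions. -/
def pathDeriv {n : ℕ} (γ : ℝ → (Fin n → ℂ) → ℝ) (t : ℝ) : (Fin n → ℂ) → ℝ :=
  fun z => deriv (fun τ => γ τ z) t

/-- The Mabuchi (Levi-Civita) covariant derivative `Dψ = dψ/dt - ⟨∇ψ, ∇γ̇⟩_γ` of a vector field
`ψ` along a path `γ`. -/
def covDeriv {n : ℕ} (γ ψ : ℝ → (Fin n → ℂ) → ℝ) (t : ℝ) : (Fin n → ℂ) → ℝ :=
  fun z => pathDeriv ψ t z - gradInner (γ t) (ψ t) (pathDeriv γ t) z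

/-- `φ_t = dφ/dt` for a two-parameter family. -/
def partialT {n : ℕ} (φ : ℝ → ℝ → (Fin n → ℂ) → ℝ) (t s : ℝ) : (Fin n → ℂ) → ℝ :=
  pathDeriv (fun τ => φ τ s) t

/-- `φ_s = dφ/ds` for a two-parameter family. -/
def partialS {n : ℕ} (φ : ℝ → ℝ → (Fin n → ℂ) → ℝ) (t s : ℝ) : (Fin n → ℂ) → ℝ :=
  pathDeriv (φ t) s

/-- `D_t ψ`, the covariant derivative along `t ↦ φ(t, s)`. -/
def covDerivT {n : ℕ} (φ ψ : ℝ → ℝ → (Fin n → ℂ) → ℝ) (t s : ℝ) : (Fin n → ℂ) → ℝ :=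
  covDeriv (fun τ => φ τ s) (fun τ => ψ τ s) t

/-- `D_s ψ`, the covariant derivative along `s ↦ φ(t, s)`. -/
def covDerivS {n : ℕ} (φ ψ : ℝ → ℝ → (Fin n → ℂ) → ℝ) (t s : ℝ) : (Fin n → ℂ) → ℝ :=
  covDeriv (φ t) (ψ t) s

/-- The curvature `R_φ(φ_t, φ_s)ψ = D_s D_t ψ - D_t D_s ψ`. This is the sign convention
`R(X, Y) = D_Y D_X - D_X D_Y + D_{[X, Y]}`, for which `⟨R(X, Y)X, Y⟩` is the (unnormalised)
sectional curvature. -/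
def mabuchiCurvature {n : ℕ} (φ ψ : ℝ → ℝ → (Fin n → ℂ) → ℝ) (t s : ℝ) : (Fin n → ℂ) → ℝ :=
  fun z => covDerivS φ (covDerivT φ ψ) t s z - covDerivT φ (covDerivS φ ψ) t s z

/-- The Mabuchi metric `⟪f, g⟫_φ = ∫_Ω f g (dd^c φ)^n`. -/
def mabuchiInner {n : ℕ} (Ω : Set (Fin n → ℂ)) (φ f g : (Fin n → ℂ) → ℝ) : ℝ :=
  ∫ z in Ω, f z * g z * mongeAmpereDensity φ z

/-- The norm `‖f‖_φ` of the Mabuchi metric. -/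
def mabuchiNorm {n : ℕ} (Ω : Set (Fin n → ℂ)) (φ f : (Fin n → ℂ) → ℝ) : ℝ :=
  Real.sqrt (mabuchiInner Ω φ f f)

/-- The (unnormalised) sectional curvature `K_φ(φ_t, φ_s) = ⟪R_φ(φ_t, φ_s)φ_t, φ_s⟫_φ`. -/
def mabuchiSectional {n : ℕ} (Ω : Set (Fin n → ℂ)) (φ : ℝ → ℝ → (Fin n → ℂ) → ℝ) (t s : ℝ) : ℝ :=
  mabuchiInner Ω (φ t s) (mabuchiCurvature φ (partialT φ) t s) (partialS φ t s)

end

/-!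
The covariant derivatives `D_t` and `D_s` are derivations in the function they are applied to: they
are `∂_t` and `∂_s` minus half the sum of the `(1,0)` and `(0,1)` gradient fields of `φ_t`
and `φ_s`. Hence `D_s D_t - D_t D_s` is again a derivation, a vector field on `ℂⁿ`, and
the curvature formula says that it is minus the Hamiltonian field of `w = {φ_t, φ_s}`. It is enough to
compare components, and lowering their index with `φ_{αβ̄}` leaves an identity that follows from the
symmetry of the derivatives of `φ` (`lower_commutator_raise`, `covDerivation_comm`). This part is
algebra in a commutative ring with commuting derivations. It is applied to the ring of germs of smooth
functions at a point `((t, s), z)` (`smoothGerm`), which gives the formula at all points of the closed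
domain, boundary included (`FamilyGerm.mabuchiCurvature_eq`).

For the sectional curvature, Jacobi's formula for `det (φ_{αβ̄})` shows that `{f, u}_φ` times
the Monge-Ampère density is a divergence of fields proportional to `f` (`det_mul_formalBracket`).
If `f` vanishes on the boundary, its integral is zero: the coefficients extended by zero are
Lipschitz with compact support, and the boundary is a null set (`integral_fderiv_eq_zero`).
With `f = w φ_s` and `u = φ_t`, the Leibniz rule yields `∫ φ_s {w, φ_t} = ∫ w²`, which is the claim.
-/

open scoped ContDiff ComplexOrder
open Filter Topology

noncomputable section

/-! ### Algebra of commuting derivations on a Kähler chart -/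

section Jacobi

theorem Derivation.leibniz_finset_prod_erase {R ι : Type*} [CommRing R] [Algebra ℂ R]
    [DecidableEq ι] (δ : Derivation ℂ R R) (s : Finset ι) (f : ι → R) :
    δ (∏ i ∈ s, f i) = ∑ i ∈ s, (∏ j ∈ s.erase i, f j) * δ (f i) := by
  induction s using Finset.induction_on with
  | empty => simp
  | insert a s ha ih =>
    rw [Finset.prod_insert ha, Derivation.leibniz, ih, Finset.sum_insert ha,
      Finset.erase_insert ha, smul_eq_mul, smul_eq_mul, Finset.mul_sum, add_comm]
    congr 1
    refine Finset.sum_congr rfl fun i hi => ?_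
    have hia : a ≠ i := fun h => ha (h ▸ hi)
    rw [Finset.erase_insert_of_ne hia, Finset.prod_insert (fun h => ha (Finset.mem_of_mem_erase h)),
      mul_assoc]

/-- Jacobi's formula for the derivative of a determinant. -/
theorem Derivation.map_det {R ι : Type*} [CommRing R] [Algebra ℂ R] [Fintype ι] [DecidableEq ι]
    (δ : Derivation ℂ R R) (M : Matrix ι ι R) :
    δ M.det = ∑ i, ∑ j, M.adjugate i j * δ (M j i) := by
  have h1 : ∀ i, ∑ j, M.adjugate i j * δ (M j i) = (M.updateCol i fun k => δ (M k i)).det := by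
    intro i
    rw [← Matrix.cramer_apply, Matrix.cramer_eq_adjugate_mulVec]
    rfl
  simp_rw [h1, Matrix.det_apply]
  rw [Finset.sum_comm, map_sum]
  refine Finset.sum_congr rfl fun σ _ => ?_
  rw [← Finset.smul_sum, Units.smul_def, Units.smul_def, map_zsmul,
    Derivation.leibniz_finset_prod_erase]
  congr 1
  refine Finset.sum_congr rfl fun i _ => ?_
  rw [← Finset.mul_prod_erase _ _ (Finset.mem_univ i), Matrix.updateCol_self, mul_comm]
  congr 1
  refine Finset.prod_congr rfl fun j hj => ?_
  rw [Matrix.updateCol_ne (Finset.ne_of_mem_erase hj)]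

end Jacobi

section Algebra

variable {R ι : Type*} [CommRing R] [Algebra ℂ R] [Fintype ι]

/-- Solving `∑_γ H_{γβ} X_γ = Y_β` for `X`. -/
theorem raise_lower {R ι : Type*} [CommRing R] [Fintype ι] [DecidableEq ι] {A H : Matrix ι ι R}
    (hA : H.transpose * A = 1) {X Y : ι → R}
    (h : ∀ β, ∑ γ, H γ β * X γ = Y β) (γ : ι) : X γ = ∑ β, A γ β * Y β := by
  have h1 : A.mulVec (H.transpose.mulVec X) γ = X γ := by
    rw [Matrix.mulVec_mulVec, mul_eq_one_comm.mp hA, Matrix.one_mulVec]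
  rw [← h1]
  exact Finset.sum_congr rfl fun β _ => congrArg _ (h β)

/-- The components `u^α = ∑_β A_{αβ} d̄_β u` of the `(1,0)` gradient field of `u`. With `Aᵀ` and `d` in
place of `A` and `d̄` these are the `(0,1)` components. -/
def raiseIndex (A : Matrix ι ι R) (db : ι → Derivation ℂ R R) (u : R) (α : ι) : R :=
  ∑ β, A α β * db β u

/-- The pairing `∑ A_{αβ} d_α f · d̄_β g`, the complex-valued form whose symmetric and antisymmetric
parts give the gradient product and the Poisson bracket. -/
def gradPairing (A : Matrix ι ι R) (d db : ι → Derivation ℂ R R) (f g : R) : R :=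
  ∑ α, ∑ β, A α β * (d α f * db β g)

theorem gradPairing_transpose (A : Matrix ι ι R) (d db : ι → Derivation ℂ R R) (f g : R) :
    gradPairing A.transpose db d f g = gradPairing A d db g f := by
  rw [gradPairing, gradPairing, Finset.sum_comm]
  simp only [Matrix.transpose_apply, mul_comm]

theorem gradPairing_eq_sum_raise (A : Matrix ι ι R) (d db : ι → Derivation ℂ R R) (f g : R) :
    gradPairing A d db f g = ∑ α, raiseIndex A db g α * d α f := by
  simp only [gradPairing, raiseIndex, Finset.sum_mul]
  refine Finset.sum_congr rfl fun α _ => Finset.sum_congr rfl fun β _ => by ring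

theorem gradPairing_eq_sum_raise_transpose (A : Matrix ι ι R) (d db : ι → Derivation ℂ R R)
    (f g : R) :
    gradPairing A d db f g = ∑ β, raiseIndex A.transpose d f β * db β g := by
  rw [← gradPairing_transpose, gradPairing_eq_sum_raise]

/-- The Mabuchi covariant derivative `δ - ⟨∇ ·, ∇ v⟩` along a path with velocity `v`, where `δ`
differentiates in the parameter. Since `⟨∇ ·, ∇ v⟩` is half the sum of the `(1,0)` and `(0,1)`
gradient fields of `v`, this is a derivation. -/
def covDerivation (A : Matrix ι ι R) (d db : ι → Derivation ℂ R R)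
    (δ : Derivation ℂ R R) (v : R) : Derivation ℂ R R :=
  δ - (1 / 2 : ℂ) • (∑ α, raiseIndex A db v α • d α + ∑ β, raiseIndex A.transpose d v β • db β)

theorem covDerivation_apply (A : Matrix ι ι R) (d db : ι → Derivation ℂ R R)
    (δ : Derivation ℂ R R) (v x : R) :
    covDerivation A d db δ v x = δ x - algebraMap ℂ R (1 / 2) *
      (∑ α, raiseIndex A db v α * d α x + ∑ β, raiseIndex A.transpose d v β * db β x) := by
  have hs : ∀ (a : ι → R) (D : ι → Derivation ℂ R R), (∑ α, a α • D α) x = ∑ α, a α * D α x := by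
    intro a D
    have := map_sum (Derivation.coeFnAddMonoidHom (R := ℂ) (A := R) (M := R))
      (fun α => a α • D α) Finset.univ
    refine (congrFun this x).trans ?_
    rw [Finset.sum_apply]
    rfl
  rw [covDerivation, Derivation.sub_apply, Derivation.smul_apply, Derivation.add_apply, hs, hs,
    Algebra.smul_def]

/-- The Poisson bracket `(i/2) ∑ A_{αβ} (d̄_β f · d_α g - d_α f · d̄_β g)`. -/
def formalBracket (A : Matrix ι ι R) (d db : ι → Derivation ℂ R R) (f g : R) : R :=
  algebraMap ℂ R (Complex.I / 2) * (gradPairing A d db g f - gradPairing A d db f g)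

theorem formalBracket_antisymm (A : Matrix ι ι R) (d db : ι → Derivation ℂ R R) (f g : R) :
    formalBracket A d db f g = - formalBracket A d db g f := by
  rw [formalBracket, formalBracket]
  ring

theorem formalBracket_mul_left (A : Matrix ι ι R) (d db : ι → Derivation ℂ R R) (f g u : R) :
    formalBracket A d db (f * g) u =
      f * formalBracket A d db g u + g * formalBracket A d db f u := by
  have h1 : gradPairing A d db u (f * g) =
      f * gradPairing A d db u g + g * gradPairing A d db u f := by
    simp only [gradPairing_eq_sum_raise_transpose, Finset.mul_sum, ← Finset.sum_add_distrib,
      Derivation.leibniz, smul_eq_mul]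
    exact Finset.sum_congr rfl fun β _ => by ring
  have h2 : gradPairing A d db (f * g) u =
      f * gradPairing A d db g u + g * gradPairing A d db f u := by
    simp only [gradPairing_eq_sum_raise, Finset.mul_sum, ← Finset.sum_add_distrib,
      Derivation.leibniz, smul_eq_mul]
    exact Finset.sum_congr rfl fun β _ => by ring
  rw [formalBracket, formalBracket, formalBracket, h1, h2]
  ring

variable [DecidableEq ι]

theorem lower_raise {A H : Matrix ι ι R} (hA : H.transpose * A = 1) (db : ι → Derivation ℂ R R)
    (u : R) (β : ι) : ∑ γ, H γ β * raiseIndex A db u γ = db β u := by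
  have h : H.transpose.mulVec (A.mulVec fun β => db β u) β = db β u := by
    rw [Matrix.mulVec_mulVec, hA, Matrix.one_mulVec]
  exact h

/-- The Leibniz rule applied to `∑_γ H_{γβ} u^γ = u_β̄`. It replaces the formula for the derivative
of an inverse matrix. -/
theorem lower_derivation_raise {A H : Matrix ι ι R} (hA : H.transpose * A = 1)
    (db : ι → Derivation ℂ R R) (δ : Derivation ℂ R R) (u : R) (β : ι) :
    ∑ γ, H γ β * δ (raiseIndex A db u γ) =
      δ (db β u) - ∑ γ, δ (H γ β) * raiseIndex A db u γ := by
  rw [← lower_raise hA db u β, map_sum, ← Finset.sum_sub_distrib]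
  refine Finset.sum_congr rfl fun γ _ => ?_
  rw [Derivation.leibniz, smul_eq_mul, smul_eq_mul]
  ring

theorem derivation_gradPairing {A H : Matrix ι ι R} (hA : H.transpose * A = 1)
    (d db : ι → Derivation ℂ R R) (δ : Derivation ℂ R R) (f g : R) :
    δ (gradPairing A d db f g) = ∑ α, raiseIndex A db g α * δ (d α f)
      + ∑ β, raiseIndex A.transpose d f β * δ (db β g)
      - ∑ α, ∑ β, raiseIndex A.transpose d f β * (δ (H α β) * raiseIndex A db g α) := by
  have hT : H.transpose.transpose * A.transpose = 1 := by
    rw [Matrix.transpose_transpose, ← Matrix.transpose_transpose H, ← Matrix.transpose_mul,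
      mul_eq_one_comm.mp hA, Matrix.transpose_one]
  have key : ∑ α, d α f * δ (raiseIndex A db g α) =
      ∑ β, raiseIndex A.transpose d f β * (∑ γ, H γ β * δ (raiseIndex A db g γ)) := by
    simp_rw [Finset.mul_sum]
    rw [Finset.sum_comm]
    refine Finset.sum_congr rfl fun α _ => ?_
    rw [← lower_raise hT d f α, Finset.sum_mul]
    refine Finset.sum_congr rfl fun β _ => ?_
    rw [Matrix.transpose_apply]
    ring
  simp_rw [lower_derivation_raise hA] at key
  have e : ∑ α, ∑ β, raiseIndex A.transpose d f β * (δ (H α β) * raiseIndex A db g α) =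
      ∑ β, raiseIndex A.transpose d f β * ∑ γ, δ (H γ β) * raiseIndex A db g γ := by
    rw [Finset.sum_comm]
    simp_rw [Finset.mul_sum]
  rw [e, gradPairing_eq_sum_raise, map_sum]
  simp_rw [Derivation.leibniz, smul_eq_mul, Finset.sum_add_distrib, key, mul_sub,
    Finset.sum_sub_distrib]
  ring

/-- The heart of the curvature computation: the `(1,0)` components of the commutator of the two
covariant derivatives, with their index lowered. Working with lowered indices, where
`lower_derivation_raise` applies, no derivative of the inverse matrix occurs; the symmetry of the
third derivatives of `Φ` then turns the result into `∂̄_β` of a function. -/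
theorem lower_commutator_raise {A H : Matrix ι ι R} (hA : H.transpose * A = 1)
    {d db : ι → Derivation ℂ R R} {dt ds : Derivation ℂ R R} {Φ : R}
    (hH : ∀ α β, H α β = d α (db β Φ))
    (dd : ∀ α β x, d α (d β x) = d β (d α x)) (dbdb : ∀ α β x, db α (db β x) = db β (db α x))
    (ddb : ∀ α β x, d α (db β x) = db β (d α x))
    (td : ∀ α x, dt (d α x) = d α (dt x)) (tdb : ∀ α x, dt (db α x) = db α (dt x))
    (sd : ∀ α x, ds (d α x) = d α (ds x)) (sdb : ∀ α x, ds (db α x) = db α (ds x))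
    (st : ∀ x, ds (dt x) = dt (ds x)) (β : ι) :
    ∑ γ, H γ β * (covDerivation A d db ds (ds Φ) (raiseIndex A db (dt Φ) γ) -
        covDerivation A d db dt (dt Φ) (raiseIndex A db (ds Φ) γ)) =
      - (algebraMap ℂ R (1 / 2) *
        db β (gradPairing A d db (ds Φ) (dt Φ) - gradPairing A d db (dt Φ) (ds Φ))) := by
  have hh : algebraMap ℂ R (1 / 2) + algebraMap ℂ R (1 / 2) = 1 := by
    rw [← map_add, ← map_one (algebraMap ℂ R)]
    norm_num
  simp_rw [mul_sub, Finset.sum_sub_distrib]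
  rw [lower_derivation_raise hA, lower_derivation_raise hA, map_sub, derivation_gradPairing hA,
    derivation_gradPairing hA]
  -- Commuting the derivatives of `Φ` and reordering sums brings both sides to the same terms.
  have e1 : ∀ f g : R, ∑ γ, (∑ α, raiseIndex A db f α * d α (H γ β)) * raiseIndex A db g γ =
      ∑ γ, (∑ α, raiseIndex A db g α * d α (H γ β)) * raiseIndex A db f γ := by
    intro f g
    simp_rw [Finset.sum_mul]
    rw [Finset.sum_comm]
    refine Finset.sum_congr rfl fun α _ => Finset.sum_congr rfl fun γ _ => ?_
    rw [hH, hH, dd]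
    ring
  have e2 : ∀ f g : R, ∑ γ, (∑ β', raiseIndex A.transpose d f β' * db β' (H γ β)) *
      raiseIndex A db g γ =
      ∑ α, ∑ β', raiseIndex A.transpose d f β' * (db β (H α β') * raiseIndex A db g α) := by
    intro f g
    simp_rw [Finset.sum_mul]
    refine Finset.sum_congr rfl fun α _ => Finset.sum_congr rfl fun γ _ => ?_
    rw [hH, hH, ddb, dbdb, ← ddb]
    ring
  have e3 : ∀ f g : R, ∑ α, raiseIndex A db f α * db β (d α g) =
      ∑ α, raiseIndex A db f α * d α (db β g) := fun f g =>
    Finset.sum_congr rfl fun α _ => by rw [ddb]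
  have e4 : ∀ f g : R, ∑ α, raiseIndex A.transpose d f α * db β (db α g) =
      ∑ α, raiseIndex A.transpose d f α * db α (db β g) := fun f g =>
    Finset.sum_congr rfl fun α _ => by rw [dbdb]
  have e5 : ∀ f g : R, ∑ γ, d γ (db β f) * raiseIndex A db g γ =
      ∑ γ, raiseIndex A db g γ * d γ (db β f) := fun f g =>
    Finset.sum_congr rfl fun α _ => mul_comm _ _
  have e6 : ds (db β (dt Φ)) = dt (db β (ds Φ)) := by rw [sdb, tdb, st]
  have hs : ∀ γ, ds (H γ β) = d γ (db β (ds Φ)) := fun γ => by rw [hH, sd, sdb]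
  have ht : ∀ γ, dt (H γ β) = d γ (db β (dt Φ)) := fun γ => by rw [hH, td, tdb]
  simp only [covDerivation_apply, hs, ht, sub_mul, add_mul, mul_add, Finset.sum_sub_distrib,
    Finset.sum_add_distrib, mul_assoc, ← Finset.mul_sum, e2, e3, e4, e5, e6]
  rw [e1 (dt Φ) (ds Φ)]
  linear_combination (∑ γ, raiseIndex A db (dt Φ) γ * d γ (db β (ds Φ)) -
    ∑ γ, raiseIndex A db (ds Φ) γ * d γ (db β (dt Φ))) * hh

theorem commutator_raise {A H : Matrix ι ι R} (hA : H.transpose * A = 1)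
    {d db : ι → Derivation ℂ R R} {dt ds : Derivation ℂ R R} {Φ : R}
    (hH : ∀ α β, H α β = d α (db β Φ))
    (dd : ∀ α β x, d α (d β x) = d β (d α x)) (dbdb : ∀ α β x, db α (db β x) = db β (db α x))
    (ddb : ∀ α β x, d α (db β x) = db β (d α x))
    (td : ∀ α x, dt (d α x) = d α (dt x)) (tdb : ∀ α x, dt (db α x) = db α (dt x))
    (sd : ∀ α x, ds (d α x) = d α (ds x)) (sdb : ∀ α x, ds (db α x) = db α (ds x))
    (st : ∀ x, ds (dt x) = dt (ds x)) (γ : ι) :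
    covDerivation A d db ds (ds Φ) (raiseIndex A db (dt Φ) γ) -
        covDerivation A d db dt (dt Φ) (raiseIndex A db (ds Φ) γ) =
      - (algebraMap ℂ R (1 / 2) *
        raiseIndex A db (gradPairing A d db (ds Φ) (dt Φ) - gradPairing A d db (dt Φ) (ds Φ)) γ) := by
  rw [raise_lower hA (lower_commutator_raise hA hH dd dbdb ddb td tdb sd sdb st) γ, raiseIndex,
    Finset.mul_sum, ← Finset.sum_neg_distrib]
  exact Finset.sum_congr rfl fun β _ => by ring

/-- The curvature of the Mabuchi connection as an identity in a ring with commuting derivations. The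
commutator of two derivations is first order, so the second derivatives of `ψ` cancel and only the
components computed in `commutator_raise` remain: its `(1,0)` part as stated there, its `(0,1)` part
by the symmetry exchanging `d` with `d̄` and `A` with `Aᵀ`. -/
theorem covDerivation_comm {A H : Matrix ι ι R} (hA : H.transpose * A = 1)
    {d db : ι → Derivation ℂ R R} {dt ds : Derivation ℂ R R} {Φ : R}
    (hH : ∀ α β, H α β = d α (db β Φ))
    (dd : ∀ α β x, d α (d β x) = d β (d α x)) (dbdb : ∀ α β x, db α (db β x) = db β (db α x))
    (ddb : ∀ α β x, d α (db β x) = db β (d α x))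
    (td : ∀ α x, dt (d α x) = d α (dt x)) (tdb : ∀ α x, dt (db α x) = db α (dt x))
    (sd : ∀ α x, ds (d α x) = d α (ds x)) (sdb : ∀ α x, ds (db α x) = db α (ds x))
    (st : ∀ x, ds (dt x) = dt (ds x)) (ψ : R) :
    covDerivation A d db ds (ds Φ) (covDerivation A d db dt (dt Φ) ψ) -
        covDerivation A d db dt (dt Φ) (covDerivation A d db ds (ds Φ) ψ) =
      - formalBracket A d db (formalBracket A d db (dt Φ) (ds Φ)) ψ := by
  have hT : H.transpose.transpose * A.transpose = 1 := by
    rw [Matrix.transpose_transpose, ← Matrix.transpose_transpose H, ← Matrix.transpose_mul,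
      mul_eq_one_comm.mp hA, Matrix.transpose_one]
  have c1 := commutator_raise hA hH dd dbdb ddb td tdb sd sdb st
  have c2 := commutator_raise (d := db) (db := d) hT
    (fun α β => by rw [Matrix.transpose_apply, hH, ddb]) dbdb dd (fun α β x => (ddb β α x).symm)
    tdb td sdb sd st
  set u := dt Φ with hu
  set v := ds Φ with hv
  set W := gradPairing A d db v u - gradPairing A d db u v with hW
  have hswap : ∀ (δ : Derivation ℂ R R) w x, covDerivation A.transpose db d δ w x =
      covDerivation A d db δ w x := by
    intro δ w x
    rw [covDerivation_apply, covDerivation_apply, Matrix.transpose_transpose, add_comm (∑ α, _)]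
  simp only [hswap, gradPairing_transpose] at c2
  have hWt : gradPairing A d db u v - gradPairing A d db v u = -W := by rw [hW]; ring
  rw [hWt] at c2
  -- Both covariant derivatives of `ψ`, expanded by the Leibniz rule along the outer derivation.
  have expand : ∀ (δ : Derivation ℂ R R) (w : R) (D : Derivation ℂ R R),
      D (covDerivation A d db δ w ψ) = D (δ ψ) - algebraMap ℂ R (1 / 2) *
        (∑ α, D (raiseIndex A db w α) * d α ψ + ∑ β, D (raiseIndex A.transpose d w β) * db β ψ
          + ∑ α, raiseIndex A db w α * D (d α ψ)
          + ∑ β, raiseIndex A.transpose d w β * D (db β ψ)) := by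
    intro δ w D
    rw [covDerivation_apply, map_sub, Derivation.leibniz, Derivation.map_algebraMap, map_add,
      map_sum, map_sum]
    simp only [Derivation.leibniz, smul_eq_mul, Finset.sum_add_distrib, mul_zero, add_zero]
    simp only [mul_comm (d _ ψ), mul_comm (db _ ψ)]
    ring
  have m1 : ∑ α, covDerivation A d db ds v (raiseIndex A db u α) * d α ψ =
      ∑ α, covDerivation A d db dt u (raiseIndex A db v α) * d α ψ -
        algebraMap ℂ R (1 / 2) * gradPairing A d db ψ W := by
    rw [gradPairing_eq_sum_raise, Finset.mul_sum, ← Finset.sum_sub_distrib]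
    exact Finset.sum_congr rfl fun α _ => by linear_combination (d α ψ) * c1 α
  have m2 : ∑ β, covDerivation A d db ds v (raiseIndex A.transpose d u β) * db β ψ =
      ∑ β, covDerivation A d db dt u (raiseIndex A.transpose d v β) * db β ψ +
        algebraMap ℂ R (1 / 2) * gradPairing A d db W ψ := by
    rw [gradPairing_eq_sum_raise_transpose, Finset.mul_sum, ← Finset.sum_add_distrib]
    refine Finset.sum_congr rfl fun β _ => ?_
    have hneg : raiseIndex A.transpose d (-W) β = - raiseIndex A.transpose d W β := by
      simp [raiseIndex]
    have := c2 β
    rw [hneg] at this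
    linear_combination (db β ψ) * this
  have m3 : ∀ w w' : R, ∑ α, raiseIndex A db w α * ∑ α', raiseIndex A db w' α' * d α' (d α ψ) =
      ∑ α, raiseIndex A db w' α * ∑ α', raiseIndex A db w α' * d α' (d α ψ) := by
    intro w w'
    simp_rw [Finset.mul_sum]
    rw [Finset.sum_comm]
    refine Finset.sum_congr rfl fun α _ => Finset.sum_congr rfl fun α' _ => ?_
    rw [dd]
    ring
  have m4 : ∀ w w' : R, ∑ α, raiseIndex A.transpose d w α *
      ∑ α', raiseIndex A.transpose d w' α' * db α' (db α ψ) =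
      ∑ α, raiseIndex A.transpose d w' α *
        ∑ α', raiseIndex A.transpose d w α' * db α' (db α ψ) := by
    intro w w'
    simp_rw [Finset.mul_sum]
    rw [Finset.sum_comm]
    refine Finset.sum_congr rfl fun α _ => Finset.sum_congr rfl fun α' _ => ?_
    rw [dbdb]
    ring
  have m5 : ∀ w w' : R, ∑ α, raiseIndex A.transpose d w α *
      ∑ α', raiseIndex A db w' α' * d α' (db α ψ) =
      ∑ α, raiseIndex A db w' α *
        ∑ α', raiseIndex A.transpose d w α' * db α' (d α ψ) := by
    intro w w'
    simp_rw [Finset.mul_sum]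
    rw [Finset.sum_comm]
    refine Finset.sum_congr rfl fun α _ => Finset.sum_congr rfl fun α' _ => ?_
    rw [ddb]
    ring
  have hI : algebraMap ℂ R (Complex.I / 2) * algebraMap ℂ R (Complex.I / 2) =
      - (algebraMap ℂ R (1 / 2) * algebraMap ℂ R (1 / 2)) := by
    rw [← map_mul, ← map_mul, ← map_neg]
    congr 1
    linear_combination (1 / 4) * Complex.I_mul_I
  have hb : formalBracket A d db (formalBracket A d db u v) ψ =
      - (algebraMap ℂ R (1 / 2) * algebraMap ℂ R (1 / 2)) *
        (gradPairing A d db ψ W - gradPairing A d db W ψ) := by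
    rw [formalBracket, formalBracket, ← hW, ← hI, gradPairing_eq_sum_raise,
      gradPairing_eq_sum_raise_transpose _ _ _ (_ * W),
      gradPairing_eq_sum_raise, gradPairing_eq_sum_raise_transpose _ _ _ W]
    have r1 : ∀ α, raiseIndex A db (algebraMap ℂ R (Complex.I / 2) * W) α =
        algebraMap ℂ R (Complex.I / 2) * raiseIndex A db W α := fun α => by
      simp only [raiseIndex, Derivation.leibniz, Derivation.map_algebraMap, smul_eq_mul, mul_zero,
        add_zero, Finset.mul_sum]
      exact Finset.sum_congr rfl fun β _ => by ring
    have r2 : ∀ α, raiseIndex A.transpose d (algebraMap ℂ R (Complex.I / 2) * W) α =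
        algebraMap ℂ R (Complex.I / 2) * raiseIndex A.transpose d W α := fun α => by
      simp only [raiseIndex, Derivation.leibniz, Derivation.map_algebraMap, smul_eq_mul, mul_zero,
        add_zero, Finset.mul_sum]
      exact Finset.sum_congr rfl fun β _ => by ring
    simp only [r1, r2, mul_assoc, ← Finset.mul_sum]
    ring
  rw [expand, expand, m1, m2, hb]
  simp only [covDerivation_apply A d db ds v, covDerivation_apply A d db dt u, mul_sub,
    Finset.sum_sub_distrib, mul_add, Finset.sum_add_distrib, mul_left_comm _ (algebraMap ℂ R _),
    ← Finset.mul_sum, td, tdb, sd, sdb, st]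
  rw [m3 u v, m4 u v, m5 u v, m5 v u]
  ring

/-- Against the volume density `det H`, the Poisson bracket with a fixed `u` is a divergence: the
terms in which a derivative falls on `det H`, on `A` or on a derivative of `u` add up to
`det H · f · ∑ A_{αβ} d_α d̄_β u` in both sums and cancel. -/
theorem det_mul_formalBracket {A H : Matrix ι ι R} (hA : H.transpose * A = 1)
    {d db : ι → Derivation ℂ R R} {Φ : R} (hH : ∀ α β, H α β = d α (db β Φ))
    (dd : ∀ α β x, d α (d β x) = d β (d α x)) (dbdb : ∀ α β x, db α (db β x) = db β (db α x))
    (ddb : ∀ α β x, d α (db β x) = db β (d α x)) (f u : R) :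
    H.det * formalBracket A d db f u = algebraMap ℂ R (Complex.I / 2) *
      (∑ β, db β (H.det * raiseIndex A.transpose d u β * f) -
        ∑ α, d α (H.det * raiseIndex A db u α * f)) := by
  -- The coordinate formula for the Laplacian.
  have key : ∀ {A H : Matrix ι ι R}, H.transpose * A = 1 → ∀ {d db : ι → Derivation ℂ R R} {Φ : R},
      (∀ α β, H α β = d α (db β Φ)) → (∀ α β x, d α (d β x) = d β (d α x)) → ∀ u f : R,
      ∑ α, d α (H.det * raiseIndex A db u α * f) =
        H.det * (∑ α, ∑ β, A α β * d α (db β u)) * f + H.det * gradPairing A d db f u := by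
    intro A H hA d db Φ hH dd u f
    have hadj : H.adjugate = H.det • A.transpose := by
      have h1 : H * A.transpose = 1 := by
        rw [← Matrix.transpose_transpose H, ← Matrix.transpose_mul, mul_eq_one_comm.mp hA,
          Matrix.transpose_one]
      calc H.adjugate = H.adjugate * (H * A.transpose) := by rw [h1, Matrix.mul_one]
        _ = H.det • A.transpose := by
          rw [← Matrix.mul_assoc, Matrix.adjugate_mul, Matrix.smul_mul, Matrix.one_mul]
    have hdet : ∀ μ, d μ H.det = H.det * ∑ γ, ∑ β, A γ β * d γ (H μ β) := by
      intro μ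
      rw [Derivation.map_det, hadj, Finset.sum_comm, Finset.mul_sum]
      refine Finset.sum_congr rfl fun γ _ => ?_
      rw [Finset.mul_sum]
      refine Finset.sum_congr rfl fun β _ => ?_
      rw [hH, hH, dd, Matrix.smul_apply, Matrix.transpose_apply, smul_eq_mul, mul_assoc]
    have hdiv : ∑ γ, d γ (raiseIndex A db u γ) = (∑ α, ∑ β, A α β * d α (db β u)) -
        ∑ μ, (∑ γ, ∑ β, A γ β * d γ (H μ β)) * raiseIndex A db u μ := by
      have h1 : ∀ γ, d γ (raiseIndex A db u γ) = ∑ β, A γ β * d γ (db β u) -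
          ∑ μ, ∑ β, A γ β * (d γ (H μ β) * raiseIndex A db u μ) := by
        intro γ
        rw [raise_lower hA (lower_derivation_raise hA db (d γ) u) γ, Finset.sum_comm,
          ← Finset.sum_sub_distrib]
        exact Finset.sum_congr rfl fun β _ => by rw [mul_sub, Finset.mul_sum]
      simp_rw [h1]
      rw [Finset.sum_sub_distrib, Finset.sum_comm (f := fun γ μ => ∑ β, _)]
      simp_rw [Finset.sum_mul, mul_assoc]
    have hsplit : ∑ α, d α (H.det * raiseIndex A db u α * f) =
        (∑ μ, d μ H.det * raiseIndex A db u μ + H.det * ∑ γ, d γ (raiseIndex A db u γ)) * f +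
          H.det * ∑ α, raiseIndex A db u α * d α f := by
      rw [Finset.mul_sum, Finset.mul_sum, ← Finset.sum_add_distrib, Finset.sum_mul,
        ← Finset.sum_add_distrib]
      refine Finset.sum_congr rfl fun α _ => ?_
      simp only [Derivation.leibniz, smul_eq_mul]
      ring
    rw [hsplit, hdiv, gradPairing_eq_sum_raise]
    simp_rw [hdet, mul_assoc, ← Finset.mul_sum]
    ring
  have hT : H.transpose.transpose * A.transpose = 1 := by
    rw [Matrix.transpose_transpose, ← Matrix.transpose_transpose H, ← Matrix.transpose_mul,
      mul_eq_one_comm.mp hA, Matrix.transpose_one]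
  have k2 := key hT (fun α β => by rw [Matrix.transpose_apply, hH, ddb]) dbdb u f
  rw [Matrix.det_transpose, gradPairing_transpose, Finset.sum_comm] at k2
  simp_rw [Matrix.transpose_apply, ← ddb] at k2
  rw [k2, key hA hH dd, formalBracket]
  ring

end Algebra

/-! ### The ring of germs of smooth functions -/

section Germs

variable {E : Type*} [NormedAddCommGroup E] [NormedSpace ℝ E]

/-- The ring of germs at `x` of complex functions that are smooth at `x` (over `ℝ`). Passing to germs
turns the partial derivatives into commuting derivations of a commutative ring. -/
def smoothGerm (x : E) : Subring (Germ (𝓝 x) ℂ) where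
  carrier := {g | ∃ F : E → ℂ, ContDiffAt ℝ ∞ F x ∧ (F : Germ (𝓝 x) ℂ) = g}
  mul_mem' := by
    rintro _ _ ⟨F, hF, rfl⟩ ⟨G, hG, rfl⟩
    exact ⟨F * G, hF.mul hG, rfl⟩
  one_mem' := ⟨fun _ => 1, contDiffAt_const, rfl⟩
  add_mem' := by
    rintro _ _ ⟨F, hF, rfl⟩ ⟨G, hG, rfl⟩
    exact ⟨F + G, hF.add hG, rfl⟩
  zero_mem' := ⟨fun _ => 0, contDiffAt_const, rfl⟩
  neg_mem' := by
    rintro _ ⟨F, hF, rfl⟩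
    exact ⟨-F, hF.neg, rfl⟩

instance smoothGerm.instAlgebra (x : E) : Algebra ℂ (smoothGerm x) :=
  RingHom.toAlgebra
    { toFun := fun c => ⟨((fun _ => c : E → ℂ) : Germ (𝓝 x) ℂ), fun _ => c, contDiffAt_const, rfl⟩
      map_one' := rfl
      map_mul' := fun _ _ => rfl
      map_zero' := rfl
      map_add' := fun _ _ => rfl }

/-- The function `F` has germ `g` at `x`; in particular `F` is smooth there. -/
def HasGerm (x : E) (F : E → ℂ) (g : smoothGerm x) : Prop := (F : Germ (𝓝 x) ℂ) = g.1

theorem ContDiffAt.exists_hasGerm {x : E} {F : E → ℂ} (hF : ContDiffAt ℝ ∞ F x) :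
    ∃ g, HasGerm x F g := ⟨⟨F, F, hF, rfl⟩, rfl⟩

namespace HasGerm

variable {x : E} {F G : E → ℂ} {g h : smoothGerm x}

theorem congr (hF : HasGerm x F g) (hFG : G =ᶠ[𝓝 x] F) : HasGerm x G g :=
  (Germ.coe_eq.mpr hFG).trans hF

theorem eventuallyEq (hF : HasGerm x F g) (hG : HasGerm x G g) : F =ᶠ[𝓝 x] G :=
  Germ.coe_eq.mp (Eq.trans hF (Eq.symm hG))

theorem unique (hF : HasGerm x F g) (hG : HasGerm x F h) : g = h :=
  Subtype.ext ((Eq.symm hF).trans hG)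

theorem contDiffAt (hF : HasGerm x F g) : ContDiffAt ℝ ∞ F x := by
  obtain ⟨_, G, hG, rfl⟩ := g
  exact hG.congr_of_eventuallyEq (Germ.coe_eq.mp hF)

theorem const (c : ℂ) : HasGerm x (fun _ => c) (algebraMap ℂ (smoothGerm x) c) := rfl

theorem one : HasGerm x (fun _ => 1) (1 : smoothGerm x) := rfl

theorem zero : HasGerm x (fun _ => 0) (0 : smoothGerm x) := rfl

theorem add (hF : HasGerm x F g) (hG : HasGerm x G h) : HasGerm x (fun y => F y + G y) (g + h) := by
  change ((F : Germ (𝓝 x) ℂ) + (G : Germ (𝓝 x) ℂ)) = g.1 + h.1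
  rw [hF, hG]

theorem sub (hF : HasGerm x F g) (hG : HasGerm x G h) : HasGerm x (fun y => F y - G y) (g - h) := by
  change ((F : Germ (𝓝 x) ℂ) - (G : Germ (𝓝 x) ℂ)) = g.1 - h.1
  rw [hF, hG]

theorem neg (hF : HasGerm x F g) : HasGerm x (fun y => - F y) (-g) := by
  change (- (F : Germ (𝓝 x) ℂ)) = - g.1
  rw [hF]

theorem mul (hF : HasGerm x F g) (hG : HasGerm x G h) : HasGerm x (fun y => F y * G y) (g * h) := by
  change ((F : Germ (𝓝 x) ℂ) * (G : Germ (𝓝 x) ℂ)) = g.1 * h.1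
  rw [hF, hG]

theorem sum {ι : Type*} (s : Finset ι) {F : ι → E → ℂ} {g : ι → smoothGerm x}
    (hF : ∀ i, HasGerm x (F i) (g i)) : HasGerm x (fun y => ∑ i ∈ s, F i y) (∑ i ∈ s, g i) := by
  classical
  induction s using Finset.induction_on with
  | empty => exact zero
  | insert a s ha ih => simpa only [Finset.sum_insert ha] using (hF a).add ih

theorem prod {ι : Type*} (s : Finset ι) {F : ι → E → ℂ} {g : ι → smoothGerm x}
    (hF : ∀ i, HasGerm x (F i) (g i)) : HasGerm x (fun y => ∏ i ∈ s, F i y) (∏ i ∈ s, g i) := by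
  classical
  induction s using Finset.induction_on with
  | empty => exact one
  | insert a s ha ih => simpa only [Finset.prod_insert ha] using (hF a).mul ih

theorem det {ι : Type*} [Fintype ι] [DecidableEq ι] {M : E → Matrix ι ι ℂ}
    {N : Matrix ι ι (smoothGerm x)} (h : ∀ i j, HasGerm x (fun y => M y i j) (N i j)) :
    HasGerm x (fun y => (M y).det) N.det := by
  simp only [Matrix.det_apply']
  refine sum _ fun σ => mul ?_ (prod _ fun i => h _ _)
  rw [← map_intCast (algebraMap ℂ (smoothGerm x))]
  exact const _

end HasGerm

/-- The derivative of a germ in the direction `v`. On germs without a differentiable representative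
it carries the junk value of `fderiv`; it is used on smooth germs only. -/
def germDeriv (x v : E) (g : Germ (𝓝 x) ℂ) : Germ (𝓝 x) ℂ :=
  g.liftOn (fun F => ((fun y => fderiv ℝ F y v : E → ℂ) : Germ (𝓝 x) ℂ)) fun _ _ h =>
    Germ.coe_eq.mpr ((h.fderiv (𝕜 := ℝ)).mono fun _ hy => congrArg (fun L : E →L[ℝ] ℂ => L v) hy)

theorem ContDiffAt.eventually_contDiffAt_two {x : E} {F : E → ℂ} (hF : ContDiffAt ℝ ∞ F x) :
    ∀ᶠ y in 𝓝 x, ContDiffAt ℝ 2 F y :=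
  (hF.of_le (WithTop.coe_le_coe.mpr le_top : ((2 : ℕ∞) : WithTop ℕ∞) ≤ ∞)).eventually (by simp)

theorem ContDiffAt.eventually_differentiableAt {x : E} {F : E → ℂ} (hF : ContDiffAt ℝ ∞ F x) :
    ∀ᶠ y in 𝓝 x, DifferentiableAt ℝ F y :=
  hF.eventually_contDiffAt_two.mono fun _ h => h.differentiableAt (by simp)

theorem ContDiffAt.fderiv_apply_const {x : E} {F : E → ℂ} (hF : ContDiffAt ℝ ∞ F x) (v : E) :
    ContDiffAt ℝ ∞ (fun y => fderiv ℝ F y v) x :=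
  (hF.fderiv_right (m := ∞) le_rfl).clm_apply contDiffAt_const

/-- The directional derivative along `v`, as a derivation of the ring of smooth germs. -/
def dirDerivation (x v : E) : Derivation ℂ (smoothGerm x) (smoothGerm x) :=
  Derivation.mk'
    { toFun := fun g => ⟨germDeriv x v g.1, by
        obtain ⟨_, F, hF, rfl⟩ := g
        exact ⟨_, hF.fderiv_apply_const v, rfl⟩⟩
      map_add' := by
        rintro ⟨_, F, hF, rfl⟩ ⟨_, G, hG, rfl⟩
        refine Subtype.ext (Germ.coe_eq.mpr ?_)
        filter_upwards [hF.eventually_differentiableAt, hG.eventually_differentiableAt] with y h1 h2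
        exact congrArg (fun L : E →L[ℝ] ℂ => L v) (fderiv_add h1 h2)
      map_smul' := by
        rintro c ⟨_, F, hF, rfl⟩
        rw [RingHom.id_apply, Algebra.smul_def, Algebra.smul_def]
        refine Subtype.ext (Germ.coe_eq.mpr ?_)
        filter_upwards [hF.eventually_differentiableAt] with y h1
        have : fderiv ℝ (fun y => c * F y) y = c • fderiv ℝ F y := fderiv_const_mul h1 c
        exact congrArg (fun L : E →L[ℝ] ℂ => L v) this }
    (by
      rintro ⟨_, F, hF, rfl⟩ ⟨_, G, hG, rfl⟩
      refine Subtype.ext (Germ.coe_eq.mpr ?_)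
      filter_upwards [hF.eventually_differentiableAt, hG.eventually_differentiableAt] with y h1 h2
      have : fderiv ℝ (F * G) y = F y • fderiv ℝ G y + G y • fderiv ℝ F y := fderiv_mul h1 h2
      exact congrArg (fun L : E →L[ℝ] ℂ => L v) this)

theorem HasGerm.fderiv {x : E} {F : E → ℂ} {g : smoothGerm x} (hF : HasGerm x F g) (v : E) :
    HasGerm x (fun y => fderiv ℝ F y v) (dirDerivation x v g) := by
  obtain ⟨_, G, hG, rfl⟩ := g
  exact Germ.coe_eq.mpr (((Germ.coe_eq.mp hF).fderiv (𝕜 := ℝ)).mono fun _ hy =>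
    congrArg (fun L : E →L[ℝ] ℂ => L v) hy)

theorem dirDerivation_comm (x v w : E) (g : smoothGerm x) :
    dirDerivation x v (dirDerivation x w g) = dirDerivation x w (dirDerivation x v g) := by
  obtain ⟨_, F, hF, rfl⟩ := g
  refine Subtype.ext (Germ.coe_eq.mpr ?_)
  filter_upwards [hF.eventually_contDiffAt_two] with y hy
  have hd : DifferentiableAt ℝ (_root_.fderiv ℝ F) y :=
    (hy.fderiv_right (m := 1) (by norm_num)).differentiableAt (by simp)
  have key : ∀ a b : E, _root_.fderiv ℝ (fun y => _root_.fderiv ℝ F y a) y b =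
      _root_.fderiv ℝ (_root_.fderiv ℝ F) y b a := by
    intro a b
    rw [fderiv_clm_apply hd (differentiableAt_const a)]
    simp
  rw [key, key]
  exact (hy.isSymmSndFDerivAt (by simp)) v w

theorem HasGerm.inv {x : E} {F : E → ℂ} {g : smoothGerm x} (hF : HasGerm x F g) (h0 : F x ≠ 0) :
    ∃ h, HasGerm x (fun y => (F y)⁻¹) h :=
  (hF.contDiffAt.inv h0).exists_hasGerm

/-- A matrix of smooth germs that is invertible at `x` has a smooth inverse, whose germ is inverse to
it on the level of matrices over the ring of germs. -/
theorem HasGerm.exists_matrix_inv {ι : Type*} [Fintype ι] [DecidableEq ι] {x : E}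
    {M : E → Matrix ι ι ℂ} {N : Matrix ι ι (smoothGerm x)}
    (h : ∀ i j, HasGerm x (fun y => M y i j) (N i j)) (h0 : (M x).det ≠ 0) :
    ∃ A : Matrix ι ι (smoothGerm x), (∀ i j, HasGerm x (fun y => (M y)⁻¹ i j) (A i j)) ∧
      N * A = 1 := by
  have hdet := HasGerm.det h
  obtain ⟨k, hk⟩ := hdet.inv h0
  have hA : ∀ i j, HasGerm x (fun y => (M y)⁻¹ i j) ((k • N.adjugate) i j) := by
    intro i j
    have hadj : HasGerm x (fun y => (M y).adjugate i j) (N.adjugate i j) := by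
      simp only [Matrix.adjugate_apply]
      refine HasGerm.det fun a b => ?_
      by_cases hab : a = j
      · subst hab
        simp only [Matrix.updateRow_self]
        by_cases hib : b = i
        · subst hib
          simpa using HasGerm.one
        · simpa [hib] using HasGerm.zero
      · simpa only [Matrix.updateRow_ne hab] using h a b
    have := hk.mul hadj
    simpa only [Matrix.inv_def, Matrix.smul_apply, smul_eq_mul, Ring.inverse_eq_inv'] using this
  refine ⟨_, hA, ?_⟩
  have hkd : N.det * k = 1 := by
    refine (hdet.mul hk).unique (HasGerm.one.congr ?_)
    filter_upwards [hdet.contDiffAt.continuousAt.eventually_ne h0] with y hy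
    exact mul_inv_cancel₀ hy
  rw [Matrix.mul_smul, Matrix.mul_adjugate, smul_smul, mul_comm, hkd, one_smul]

end Germs

/-! ### Integrating derivatives of functions that vanish on the boundary -/

section Divergence

open MeasureTheory Set

/-- A `C¹` function on a compact closure that vanishes on the boundary, extended by zero, is Lipschitz.
The extension need not be differentiable at boundary points, but its pointwise Lipschitz constant
is bounded everywhere by the maximum of `‖fderiv ℝ F‖`. -/
theorem exists_lipschitzWith_indicator {E : Type*} [NormedAddCommGroup E] [NormedSpace ℝ E]
    {Ω : Set E} (hΩ : IsOpen Ω) (hc : IsCompact (closure Ω)) {F : E → ℝ}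
    (hF : ∀ z ∈ closure Ω, ContDiffAt ℝ 1 F z) (h0 : ∀ z ∈ frontier Ω, F z = 0) :
    ∃ C, LipschitzWith C (Ω.indicator F) := by
  have hcont : ContinuousOn (fderiv ℝ F) (closure Ω) := fun z hz =>
    ((hF z hz).fderiv_right (m := 0) (by norm_num)).continuousAt.continuousWithinAt
  obtain ⟨C₀, hC₀⟩ := hc.exists_bound_of_continuousOn hcont
  set C := max C₀ 0 with hC
  have hloc : ∀ x, ∀ r, C < r → ∀ᶠ y in 𝓝 x,
      |Ω.indicator F y - Ω.indicator F x| ≤ r * ‖y - x‖ := by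
    intro x r hr
    have hr0 : 0 ≤ r := (le_max_right _ _).trans hr.le
    by_cases hx : x ∈ closure Ω
    · have hd : ∀ᶠ y in 𝓝 x, |F y - F x| ≤ r * ‖y - x‖ := by
        have h1 := ((hF x hx).differentiableAt (by simp)).hasFDerivAt.isLittleO.def (sub_pos.2 hr)
        filter_upwards [h1] with y hy
        have h2 : ‖fderiv ℝ F x (y - x)‖ ≤ C * ‖y - x‖ :=
          ((fderiv ℝ F x).le_opNorm _).trans
            (mul_le_mul_of_nonneg_right ((hC₀ x hx).trans (le_max_left _ _)) (norm_nonneg _))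
        calc |F y - F x| = ‖(F y - F x - fderiv ℝ F x (y - x)) + fderiv ℝ F x (y - x)‖ := by
              rw [sub_add_cancel, Real.norm_eq_abs]
          _ ≤ (r - C) * ‖y - x‖ + C * ‖y - x‖ := (norm_add_le _ _).trans (add_le_add hy h2)
          _ = r * ‖y - x‖ := by ring
      by_cases hxΩ : x ∈ Ω
      · filter_upwards [hd, hΩ.mem_nhds hxΩ] with y hy hyΩ
        rwa [indicator_of_mem hxΩ, indicator_of_mem hyΩ]
      · have hx0 : F x = 0 := h0 x (by rw [hΩ.frontier_eq]; exact ⟨hx, hxΩ⟩)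
        filter_upwards [hd] with y hy
        rw [indicator_of_notMem hxΩ]
        by_cases hyΩ : y ∈ Ω
        · rwa [indicator_of_mem hyΩ, ← hx0]
        · rw [indicator_of_notMem hyΩ, sub_zero, abs_zero]
          positivity
    · filter_upwards [isClosed_closure.isOpen_compl.mem_nhds hx] with y hy
      rw [indicator_of_notMem fun h => hx (subset_closure h),
        indicator_of_notMem fun h => hy (subset_closure h), sub_zero, abs_zero]
      positivity
  refine ⟨C.toNNReal, LipschitzWith.of_dist_le_mul fun y x => ?_⟩
  rw [Real.coe_toNNReal _ (le_max_right _ _), Real.dist_eq, dist_eq_norm]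
  rcases eq_or_ne y x with rfl | hne
  · simp
  have hpos : 0 < ‖y - x‖ := norm_pos_iff.2 (sub_ne_zero.2 hne)
  -- The pointwise estimates integrate to a global one along the segment from `x` to `y`.
  set g : ℝ → ℝ := fun τ => Ω.indicator F (x + τ • (y - x)) - Ω.indicator F x with hg
  have hgloc : ∀ τ r, C < r → ∀ᶠ τ' in 𝓝 τ, |g τ' - g τ| ≤ r * ‖y - x‖ * |τ' - τ| := by
    intro τ r hr
    have ht : Tendsto (fun τ' : ℝ => x + τ' • (y - x)) (𝓝 τ) (𝓝 (x + τ • (y - x))) :=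
      Continuous.tendsto (by fun_prop) _
    filter_upwards [ht.eventually (hloc _ r hr)] with τ' h
    have e : x + τ' • (y - x) - (x + τ • (y - x)) = (τ' - τ) • (y - x) := by
      rw [add_sub_add_left_eq_sub, ← sub_smul]
    rw [e, norm_smul, Real.norm_eq_abs] at h
    simp only [hg, sub_sub_sub_cancel_right]
    linarith
  have hgcont : Continuous g := by
    refine continuous_iff_continuousAt.2 fun τ => ?_
    rw [ContinuousAt, tendsto_iff_dist_tendsto_zero]
    simp only [Real.dist_eq]
    refine squeeze_zero' (Eventually.of_forall fun _ => abs_nonneg _)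
      (hgloc τ (C + 1) (lt_add_one C)) ?_
    have : Continuous fun τ' : ℝ => (C + 1) * ‖y - x‖ * |τ' - τ| := by fun_prop
    simpa using this.tendsto τ
  have key := image_le_of_liminf_slope_right_le_deriv_boundary (f := fun τ => |g τ|)
    (B := fun τ => C * ‖y - x‖ * τ) (B' := fun _ => C * ‖y - x‖) (a := 0) (b := 1)
    hgcont.abs.continuousOn (by simp [hg]) (by fun_prop)
    (fun τ _ => by simpa using ((hasDerivAt_id τ).const_mul (C * ‖y - x‖)).hasDerivWithinAt)
    (by
      intro τ _ r hr
      have hr' : C < (C + r / ‖y - x‖) / 2 ∧ (C + r / ‖y - x‖) / 2 * ‖y - x‖ < r := by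
        have : C < r / ‖y - x‖ := (lt_div_iff₀ hpos).2 hr
        constructor
        · linarith
        · rw [← lt_div_iff₀ hpos]
          linarith
      refine Eventually.frequently ?_
      filter_upwards [nhdsWithin_le_nhds (hgloc τ _ hr'.1), self_mem_nhdsWithin] with τ' h hτ'
      have hlt : 0 < τ' - τ := sub_pos.2 hτ'
      rw [abs_of_pos hlt] at h
      rw [slope_def_field, div_lt_iff₀ hlt]
      calc |g τ'| - |g τ| ≤ |g τ' - g τ| := abs_sub_abs_le_abs_sub _ _
        _ ≤ _ := h
        _ < r * (τ' - τ) := mul_lt_mul_of_pos_right hr'.2 hlt)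
    (show (1 : ℝ) ∈ Icc (0 : ℝ) 1 by simp)
  simpa [hg] using key

/-- A derivative of a function vanishing on the boundary integrates to zero. No regularity of the
boundary is used beyond its being a null set: the extension by zero is Lipschitz with compact
support, and integration by parts against the constant `1` applies to it. -/
theorem integral_fderiv_eq_zero_real {E : Type*} [NormedAddCommGroup E] [NormedSpace ℝ E]
    [FiniteDimensional ℝ E] [MeasurableSpace E] [BorelSpace E] {μ : Measure E} [μ.IsAddHaarMeasure]
    {Ω : Set E} (hΩ : IsOpen Ω) (hb : Bornology.IsBounded Ω) (hn : μ (frontier Ω) = 0) {F : E → ℝ}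
    (hF : ∀ z ∈ closure Ω, ContDiffAt ℝ 1 F z) (h0 : ∀ z ∈ frontier Ω, F z = 0) (v : E) :
    ∫ z in Ω, fderiv ℝ F z v ∂μ = 0 := by
  have hc : IsCompact (closure Ω) := hb.isCompact_closure
  obtain ⟨C, hL⟩ := exists_lipschitzWith_indicator hΩ hc hF h0
  have hsupp : HasCompactSupport (Ω.indicator F) :=
    HasCompactSupport.of_support_subset_isCompact hc (support_indicator_subset.trans subset_closure)
  have h1 := LipschitzWith.integral_lineDeriv_mul_eq (μ := μ)
    (LipschitzWith.const (1 : ℝ) : LipschitzWith 0 fun _ : E => (1 : ℝ)) hL hsupp (-v)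
  have h2 : ∀ x : E, lineDeriv ℝ (fun _ : E => (1 : ℝ)) x (-v) = 0 := fun x => by
    simp [lineDeriv]
  simp only [h2, zero_mul, integral_zero, neg_neg, mul_one] at h1
  rw [h1, ← integral_indicator hΩ.measurableSet]
  refine integral_congr_ae ?_
  have hae : ∀ᵐ z ∂μ, z ∉ frontier Ω := measure_eq_zero_iff_ae_notMem.1 hn
  filter_upwards [hae] with z hz
  by_cases hzΩ : z ∈ Ω
  · have he : Ω.indicator F =ᶠ[𝓝 z] F := by
      filter_upwards [hΩ.mem_nhds hzΩ] with y hy using indicator_of_mem hy F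
    rw [indicator_of_mem hzΩ, he.lineDeriv_eq,
      ((hF z (subset_closure hzΩ)).differentiableAt (by simp)).lineDeriv_eq_fderiv]
  · have hzc : z ∉ closure Ω := fun h => hz (by rw [hΩ.frontier_eq]; exact ⟨h, hzΩ⟩)
    have he : Ω.indicator F =ᶠ[𝓝 z] fun _ => 0 := by
      filter_upwards [isClosed_closure.isOpen_compl.mem_nhds hzc] with y hy
      exact indicator_of_notMem (fun h => hy (subset_closure h)) F
    rw [indicator_of_notMem hzΩ, he.lineDeriv_eq]
    simp [lineDeriv]

theorem ContinuousOn.integrableOn_of_isBounded {E G : Type*} [NormedAddCommGroup E]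
    [NormedSpace ℝ E] [FiniteDimensional ℝ E] [MeasurableSpace E] [BorelSpace E]
    [NormedAddCommGroup G] {μ : Measure E} [μ.IsAddHaarMeasure]
    {Ω : Set E} (hb : Bornology.IsBounded Ω) {F : E → G} (hF : ContinuousOn F (closure Ω)) :
    IntegrableOn F Ω μ :=
  (hF.integrableOn_compact hb.isCompact_closure).mono_set subset_closure

theorem integrableOn_fderiv_apply {E : Type*} [NormedAddCommGroup E] [NormedSpace ℝ E]
    [FiniteDimensional ℝ E] [MeasurableSpace E] [BorelSpace E] {μ : Measure E} [μ.IsAddHaarMeasure]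
    {Ω : Set E} (hb : Bornology.IsBounded Ω) {F : E → ℂ}
    (hF : ∀ z ∈ closure Ω, ContDiffAt ℝ 1 F z) (v : E) :
    IntegrableOn (fun z => fderiv ℝ F z v) Ω μ :=
  ContinuousOn.integrableOn_of_isBounded hb fun z hz =>
    (((hF z hz).fderiv_right (m := 0) (by norm_num)).continuousAt.clm_apply
      continuousAt_const).continuousWithinAt

theorem integral_fderiv_eq_zero {E : Type*} [NormedAddCommGroup E] [NormedSpace ℝ E]
    [FiniteDimensional ℝ E] [MeasurableSpace E] [BorelSpace E] {μ : Measure E} [μ.IsAddHaarMeasure]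
    {Ω : Set E} (hΩ : IsOpen Ω) (hb : Bornology.IsBounded Ω) (hn : μ (frontier Ω) = 0) {F : E → ℂ}
    (hF : ∀ z ∈ closure Ω, ContDiffAt ℝ 1 F z) (h0 : ∀ z ∈ frontier Ω, F z = 0) (v : E) :
    ∫ z in Ω, fderiv ℝ F z v ∂μ = 0 := by
  have hi := integrableOn_fderiv_apply (μ := μ) hb hF v
  have hcomp : ∀ L : ℂ →L[ℝ] ℝ, L (∫ z in Ω, fderiv ℝ F z v ∂μ) = 0 := by
    intro L
    rw [← L.integral_comp_comm hi,
      ← integral_fderiv_eq_zero_real hΩ hb hn (F := fun z => L (F z))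
        (fun z hz => L.contDiff.contDiffAt.comp z (hF z hz)) (fun z hz => by simp [h0 z hz]) v]
    refine setIntegral_congr_fun hΩ.measurableSet fun z hz => ?_
    have hd := (hF z (subset_closure hz)).differentiableAt (by simp)
    have := (L.hasFDerivAt.comp z hd.hasFDerivAt).fderiv
    exact (congrArg (fun M : E →L[ℝ] ℝ => M v) this).symm
  exact Complex.ext (hcomp Complex.reCLM) (hcomp Complex.imCLM)

/-- A set on which `ρ = 0` and `dρ ≠ 0` is a null set. On it the identity has a singular differential,
so this is the easy case of Sard's theorem. -/
theorem addHaar_zeroSet_eq_zero {E : Type*} [NormedAddCommGroup E] [NormedSpace ℝ E]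
    [FiniteDimensional ℝ E] [MeasurableSpace E] [BorelSpace E] (μ : Measure E) [μ.IsAddHaarMeasure]
    {S : Set E} {ρ : E → ℝ} (h0 : ∀ x ∈ S, ρ x = 0) (h1 : ∀ x ∈ S, fderiv ℝ ρ x ≠ 0) :
    μ S = 0 := by
  have hc : ∀ x : E, ∃ c : E, x ∈ S → fderiv ℝ ρ x c = 1 := by
    intro x
    by_cases hx : x ∈ S
    · obtain ⟨w, hw⟩ : ∃ w, fderiv ℝ ρ x w ≠ 0 := by
        by_contra! h
        exact h1 x hx (ContinuousLinearMap.ext h)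
      exact ⟨(fderiv ℝ ρ x w)⁻¹ • w, fun _ => by simp [hw]⟩
    · exact ⟨0, fun h => absurd h hx⟩
  choose c hc using hc
  -- On `S` the identity agrees with `y ↦ y - ρ y • c x`, so it has there the singular
  -- differential of the latter.
  have key := addHaar_image_eq_zero_of_det_fderivWithin_eq_zero μ (s := S) (f := fun y => y)
    (f' := fun x => ContinuousLinearMap.id ℝ E - (fderiv ℝ ρ x).smulRight (c x))
    (by
      intro x hx
      have hd : DifferentiableAt ℝ ρ x := by
        by_contra h
        exact h1 x hx (fderiv_zero_of_not_differentiableAt h)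
      have h2 := (hasFDerivAt_id x).sub (hd.hasFDerivAt.smul_const (c x))
      exact h2.hasFDerivWithinAt.congr (fun y hy => by simp [h0 y hy]) (by simp [h0 x hx]))
    (by
      intro x hx
      by_contra hdet
      have hinj := (LinearMap.equivOfDetNeZero _ hdet).injective
      have hcx : c x = 0 := by
        apply hinj
        rw [map_zero]
        change c x - fderiv ℝ ρ x (c x) • c x = 0
        rw [hc x hx, one_smul, sub_self]
      have := hc x hx
      rw [hcx, map_zero] at this
      exact zero_ne_one this)
  simpa using key

end Divergence

theorem IsSmoothStrictlyPseudoconvexDomain.volume_frontier {n : ℕ} {Ω : Set (Fin n → ℂ)}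
    (hΩ : IsSmoothStrictlyPseudoconvexDomain Ω) : MeasureTheory.volume (frontier Ω) = 0 := by
  obtain ⟨U, ρ, hU, hΩU, hρ, hΩρ, -, hd⟩ := hΩ.exists_defining
  refine addHaar_zeroSet_eq_zero _ (fun z hz => ?_) hd
  have hzU := hΩU hz.1
  have hc : ContinuousAt ρ z := (hρ.contDiffAt (hU.mem_nhds hzU)).continuousAt
  apply le_antisymm
  · refine closure_minimal (s := ρ '' Ω) (t := Set.Iic 0) ?_ isClosed_Iic
      (mem_closure_image hc hz.1)
    rintro _ ⟨y, hy, rfl⟩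
    rw [hΩρ] at hy
    exact hy.2.le
  · by_contra! h
    have hzΩ : z ∈ Ω := by
      rw [hΩρ]
      exact ⟨hzU, h⟩
    rw [hΩ.isOpen.frontier_eq] at hz
    exact hz.2 hzΩ

theorem integrableOn_wirtinger {n : ℕ} {Ω : Set (Fin n → ℂ)} (hb : Bornology.IsBounded Ω)
    {F : (Fin n → ℂ) → ℂ} (hF : ∀ z ∈ closure Ω, ContDiffAt ℝ 1 F z) (α : Fin n) :
    MeasureTheory.IntegrableOn (wirtinger α F) Ω ∧
      MeasureTheory.IntegrableOn (wirtingerBar α F) Ω := by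
  have hi := fun v => integrableOn_fderiv_apply (μ := MeasureTheory.volume) hb hF v
  exact ⟨((hi _).sub ((hi _).const_mul _)).const_mul _,
    ((hi _).add ((hi _).const_mul _)).const_mul _⟩

theorem integral_wirtinger_eq_zero {n : ℕ} {Ω : Set (Fin n → ℂ)}
    (hΩ : IsSmoothStrictlyPseudoconvexDomain Ω) {F : (Fin n → ℂ) → ℂ}
    (hF : ∀ z ∈ closure Ω, ContDiffAt ℝ 1 F z) (h0 : ∀ z ∈ frontier Ω, F z = 0) (α : Fin n) :
    ∫ z in Ω, wirtinger α F z = 0 ∧ ∫ z in Ω, wirtingerBar α F z = 0 := by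
  have hi := fun v => integrableOn_fderiv_apply (μ := MeasureTheory.volume) hΩ.isBounded hF v
  have hz := integral_fderiv_eq_zero hΩ.isOpen hΩ.isBounded hΩ.volume_frontier hF h0
  simp only [wirtinger, wirtingerBar, MeasureTheory.integral_const_mul]
  rw [MeasureTheory.integral_sub (hi _) ((hi _).const_mul _),
    MeasureTheory.integral_add (hi _) ((hi _).const_mul _), MeasureTheory.integral_const_mul,
    hz, hz]
  simp

/-! ### Germs of families and the Mabuchi connection -/

section Conjugation

variable {n : ℕ}

theorem fderiv_conj_apply {E : Type*} [NormedAddCommGroup E] [NormedSpace ℝ E] (F : E → ℂ)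
    (z v : E) : fderiv ℝ (fun w => star (F w)) z v = star (fderiv ℝ F z v) := by
  have h := Complex.conjCLE.comp_fderiv (f := F) (x := z)
  exact congrArg (fun L : E →L[ℝ] ℂ => L v) h

theorem star_wirtinger (α : Fin n) (F : (Fin n → ℂ) → ℂ) (z : Fin n → ℂ) :
    star (wirtinger α F z) = wirtingerBar α (fun w => star (F w)) z := by
  simp only [wirtinger, wirtingerBar, fderiv_conj_apply]
  simp

theorem star_dz (α : Fin n) (f : (Fin n → ℂ) → ℝ) (z : Fin n → ℂ) :
    star (dz α f z) = dzBar α f z := by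
  rw [dz, star_wirtinger, dzBar]
  simp

theorem star_dzBar (α : Fin n) (f : (Fin n → ℂ) → ℝ) (z : Fin n → ℂ) :
    star (dzBar α f z) = dz α f z := by
  rw [← star_dz, star_star]

/-- The complex form `∑ φ^{αβ̄} f_α g_β̄`, whose real part is `gradInner φ f g`. -/
def gradHermitian (φ f g : (Fin n → ℂ) → ℝ) (z : Fin n → ℂ) : ℂ :=
  ∑ α, ∑ β, inverseHessian φ z α β * (dz α f z * dzBar β g z)

theorem star_gradHermitian {φ : (Fin n → ℂ) → ℝ} {z : Fin n → ℂ}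
    (h : (complexHessian φ z).IsHermitian) (f g : (Fin n → ℂ) → ℝ) :
    star (gradHermitian φ f g z) = gradHermitian φ g f z := by
  have hA : (inverseHessian φ z).IsHermitian := h.transpose.inv
  rw [gradHermitian, gradHermitian, Finset.sum_comm, star_sum]
  refine Finset.sum_congr rfl fun β _ => ?_
  rw [star_sum]
  refine Finset.sum_congr rfl fun α _ => ?_
  rw [star_mul', star_mul', star_dz, star_dzBar, hA.apply, mul_comm (dzBar _ _ _)]

theorem ofReal_gradInner {φ : (Fin n → ℂ) → ℝ} {z : Fin n → ℂ}
    (h : (complexHessian φ z).IsHermitian) (f g : (Fin n → ℂ) → ℝ) :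
    (gradInner φ f g z : ℂ) = 1 / 2 * (gradHermitian φ f g z + gradHermitian φ g f z) := by
  rw [← star_gradHermitian h f g]
  change (((gradHermitian φ f g z).re : ℝ) : ℂ) = _
  rw [Complex.re_eq_add_conj]
  simp only [Complex.star_def]
  ring

theorem ofReal_poissonBracket {φ : (Fin n → ℂ) → ℝ} {z : Fin n → ℂ}
    (h : (complexHessian φ z).IsHermitian) (f g : (Fin n → ℂ) → ℝ) :
    (poissonBracket φ f g z : ℂ) =
      Complex.I / 2 * (gradHermitian φ g f z - gradHermitian φ f g z) := by
  have e : ∑ α, ∑ β, inverseHessian φ z α β * (dzBar β f z * dz α g z - dz α f z * dzBar β g z) =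
      gradHermitian φ g f z - gradHermitian φ f g z := by
    simp only [gradHermitian, ← Finset.sum_sub_distrib]
    exact Finset.sum_congr rfl fun α _ => Finset.sum_congr rfl fun β _ => by ring
  rw [poissonBracket, e]
  apply Complex.conj_eq_iff_re.1
  have := star_gradHermitian h f g
  have h2 := star_gradHermitian h g f
  simp only [Complex.star_def] at this h2
  have h3 : (starRingEnd ℂ) (Complex.I / 2) = -(Complex.I / 2) := by
    rw [map_div₀, Complex.conj_I, Complex.conj_ofNat, neg_div]
  rw [map_mul, map_sub, this, h2, h3]
  ring

end Conjugation

section Families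

variable {n : ℕ} {q₀ : (ℝ × ℝ) × (Fin n → ℂ)}

/-- `∂/∂z_α` on germs at a point `((t, s), z)`. -/
def holDerivation (q₀ : (ℝ × ℝ) × (Fin n → ℂ)) (α : Fin n) :
    Derivation ℂ (smoothGerm q₀) (smoothGerm q₀) :=
  (1 / 2 : ℂ) • (dirDerivation q₀ (0, Pi.single α 1) -
    Complex.I • dirDerivation q₀ (0, Pi.single α Complex.I))

/-- `∂/∂z̄_α` on germs at a point `((t, s), z)`. -/
def barDerivation (q₀ : (ℝ × ℝ) × (Fin n → ℂ)) (α : Fin n) :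
    Derivation ℂ (smoothGerm q₀) (smoothGerm q₀) :=
  (1 / 2 : ℂ) • (dirDerivation q₀ (0, Pi.single α 1) +
    Complex.I • dirDerivation q₀ (0, Pi.single α Complex.I))

theorem holDerivation_apply (α : Fin n) (g : smoothGerm q₀) : holDerivation q₀ α g =
    algebraMap ℂ _ (1 / 2) * (dirDerivation q₀ (0, Pi.single α 1) g -
      algebraMap ℂ _ Complex.I * dirDerivation q₀ (0, Pi.single α Complex.I) g) := by
  rw [holDerivation, Derivation.smul_apply, Derivation.sub_apply, Derivation.smul_apply,
    Algebra.smul_def, Algebra.smul_def]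

theorem barDerivation_apply (α : Fin n) (g : smoothGerm q₀) : barDerivation q₀ α g =
    algebraMap ℂ _ (1 / 2) * (dirDerivation q₀ (0, Pi.single α 1) g +
      algebraMap ℂ _ Complex.I * dirDerivation q₀ (0, Pi.single α Complex.I) g) := by
  rw [barDerivation, Derivation.smul_apply, Derivation.add_apply, Derivation.smul_apply,
    Algebra.smul_def, Algebra.smul_def]

theorem dirDerivation_algebraMap_mul (v : (ℝ × ℝ) × (Fin n → ℂ)) (c : ℂ) (g : smoothGerm q₀) :
    dirDerivation q₀ v (algebraMap ℂ _ c * g) = algebraMap ℂ _ c * dirDerivation q₀ v g := by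
  rw [← Algebra.smul_def, ← Algebra.smul_def, Derivation.map_smul]

theorem dirDerivation_holDerivation (v : (ℝ × ℝ) × (Fin n → ℂ)) (α : Fin n) (g : smoothGerm q₀) :
    dirDerivation q₀ v (holDerivation q₀ α g) = holDerivation q₀ α (dirDerivation q₀ v g) := by
  simp only [holDerivation_apply, dirDerivation_algebraMap_mul, map_sub,
    dirDerivation_comm _ v]

theorem dirDerivation_barDerivation (v : (ℝ × ℝ) × (Fin n → ℂ)) (α : Fin n) (g : smoothGerm q₀) :
    dirDerivation q₀ v (barDerivation q₀ α g) = barDerivation q₀ α (dirDerivation q₀ v g) := by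
  simp only [barDerivation_apply, dirDerivation_algebraMap_mul, map_add,
    dirDerivation_comm _ v]

theorem holDerivation_comm (α β : Fin n) (g : smoothGerm q₀) :
    holDerivation q₀ α (holDerivation q₀ β g) = holDerivation q₀ β (holDerivation q₀ α g) := by
  rw [holDerivation_apply α, dirDerivation_holDerivation, dirDerivation_holDerivation,
    holDerivation_apply α g, ← Algebra.smul_def, ← Algebra.smul_def, ← Algebra.smul_def,
    ← Algebra.smul_def, Derivation.map_smul, map_sub, Derivation.map_smul]

theorem holDerivation_barDerivation (α β : Fin n) (g : smoothGerm q₀) :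
    holDerivation q₀ α (barDerivation q₀ β g) = barDerivation q₀ β (holDerivation q₀ α g) := by
  rw [holDerivation_apply α, dirDerivation_barDerivation, dirDerivation_barDerivation,
    holDerivation_apply α g, ← Algebra.smul_def, ← Algebra.smul_def, ← Algebra.smul_def,
    ← Algebra.smul_def, Derivation.map_smul, map_sub, Derivation.map_smul]

theorem barDerivation_comm (α β : Fin n) (g : smoothGerm q₀) :
    barDerivation q₀ α (barDerivation q₀ β g) = barDerivation q₀ β (barDerivation q₀ α g) := by
  rw [barDerivation_apply α, dirDerivation_barDerivation, dirDerivation_barDerivation,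
    barDerivation_apply α g, ← Algebra.smul_def, ← Algebra.smul_def, ← Algebra.smul_def,
    ← Algebra.smul_def, Derivation.map_smul, map_add, Derivation.map_smul]

theorem fderiv_slice {F : (ℝ × ℝ) × (Fin n → ℂ) → ℂ} {q : (ℝ × ℝ) × (Fin n → ℂ)}
    (hF : DifferentiableAt ℝ F q) (v : Fin n → ℂ) :
    fderiv ℝ (fun z => F (q.1, z)) q.2 v = fderiv ℝ F q (0, v) := by
  have h := (hF.hasFDerivAt (x := (q.1, q.2))).comp q.2 (hasFDerivAt_prodMk_right q.1 q.2)
  have h2 : fderiv ℝ (fun z => F (q.1, z)) q.2 = _ := h.fderiv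
  rw [h2]
  simp

theorem HasGerm.wirtinger {f : ℝ → ℝ → (Fin n → ℂ) → ℂ} {g : smoothGerm q₀}
    (h : HasGerm q₀ (fun q => f q.1.1 q.1.2 q.2) g) (α : Fin n) :
    HasGerm q₀ (fun q => wirtinger α (f q.1.1 q.1.2) q.2) (holDerivation q₀ α g) := by
  rw [holDerivation_apply]
  refine ((const _).mul ((h.fderiv _).sub ((const _).mul (h.fderiv _)))).congr ?_
  filter_upwards [h.contDiffAt.eventually_differentiableAt] with q hq
  rw [← fderiv_slice hq, ← fderiv_slice hq]
  rfl

theorem HasGerm.wirtingerBar {f : ℝ → ℝ → (Fin n → ℂ) → ℂ} {g : smoothGerm q₀}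
    (h : HasGerm q₀ (fun q => f q.1.1 q.1.2 q.2) g) (α : Fin n) :
    HasGerm q₀ (fun q => wirtingerBar α (f q.1.1 q.1.2) q.2) (barDerivation q₀ α g) := by
  rw [barDerivation_apply]
  refine ((const _).mul ((h.fderiv _).add ((const _).mul (h.fderiv _)))).congr ?_
  filter_upwards [h.contDiffAt.eventually_differentiableAt] with q hq
  rw [← fderiv_slice hq, ← fderiv_slice hq]
  rfl

/-- The two-parameter family `f` of real functions, as a function of `((t, s), z)`, has germ `g` at
`q₀`. -/
def FamilyGerm (q₀ : (ℝ × ℝ) × (Fin n → ℂ)) (f : ℝ → ℝ → (Fin n → ℂ) → ℝ) (g : smoothGerm q₀) :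
    Prop :=
  HasGerm q₀ (fun q => (f q.1.1 q.1.2 q.2 : ℂ)) g

theorem IsSmoothFamily.exists_familyGerm {Ω : Set (Fin n → ℂ)} {T : Set (ℝ × ℝ)}
    {f : ℝ → ℝ → (Fin n → ℂ) → ℝ} (hf : IsSmoothFamily Ω T f) (hq : q₀ ∈ T ×ˢ closure Ω) :
    ∃ g, FamilyGerm q₀ f g := by
  obtain ⟨W, hW, hTW, hfW⟩ := hf
  exact (Complex.ofRealCLM.contDiff.contDiffAt.comp q₀
    (hfW.contDiffAt (hW.mem_nhds (hTW hq)))).exists_hasGerm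

/-- The matrix `Φ_{αβ̄}` of germs. -/
def hessianGerm (Φ : smoothGerm q₀) :
    Matrix (Fin n) (Fin n) (smoothGerm q₀) :=
  Matrix.of fun α β => holDerivation q₀ α (barDerivation q₀ β Φ)

namespace FamilyGerm

variable {f : ℝ → ℝ → (Fin n → ℂ) → ℝ} {g : smoothGerm q₀}

theorem dz (h : FamilyGerm q₀ f g) (α : Fin n) :
    HasGerm q₀ (fun q => dz α (f q.1.1 q.1.2) q.2) (holDerivation q₀ α g) :=
  HasGerm.wirtinger (f := fun t s z => (f t s z : ℂ)) h α

theorem dzBar (h : FamilyGerm q₀ f g) (α : Fin n) :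
    HasGerm q₀ (fun q => dzBar α (f q.1.1 q.1.2) q.2) (barDerivation q₀ α g) :=
  HasGerm.wirtingerBar (f := fun t s z => (f t s z : ℂ)) h α

theorem partialT (h : FamilyGerm q₀ f g) :
    FamilyGerm q₀ (partialT f) (dirDerivation q₀ ((1, 0), 0) g) := by
  refine (h.fderiv ((1, 0), 0)).congr ?_
  filter_upwards [h.contDiffAt.eventually_differentiableAt] with q hq
  have hl : HasDerivAt (fun τ : ℝ => (((τ, q.1.2), q.2) : (ℝ × ℝ) × (Fin n → ℂ)))
      ((1, 0), 0) q.1.1 :=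
    ((hasDerivAt_id q.1.1).prodMk (hasDerivAt_const _ _)).prodMk (hasDerivAt_const _ _)
  have h1 : HasDerivAt (fun τ : ℝ => (f τ q.1.2 q.2 : ℂ)) _ q.1.1 :=
    hq.hasFDerivAt.comp_hasDerivAt (x := q.1.1) (f := fun τ : ℝ => ((τ, q.1.2), q.2)) hl
  have h2 : DifferentiableAt ℝ (fun τ : ℝ => f τ q.1.2 q.2) q.1.1 := by
    exact (Complex.reCLM.hasFDerivAt.comp_hasDerivAt _ h1).differentiableAt
  exact h2.hasDerivAt.ofReal_comp.unique h1

theorem partialS (h : FamilyGerm q₀ f g) :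
    FamilyGerm q₀ (partialS f) (dirDerivation q₀ ((0, 1), 0) g) := by
  refine (h.fderiv ((0, 1), 0)).congr ?_
  filter_upwards [h.contDiffAt.eventually_differentiableAt] with q hq
  have hl : HasDerivAt (fun τ : ℝ => (((q.1.1, τ), q.2) : (ℝ × ℝ) × (Fin n → ℂ)))
      ((0, 1), 0) q.1.2 :=
    ((hasDerivAt_const _ _).prodMk (hasDerivAt_id q.1.2)).prodMk (hasDerivAt_const _ _)
  have h1 : HasDerivAt (fun τ : ℝ => (f q.1.1 τ q.2 : ℂ)) _ q.1.2 :=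
    hq.hasFDerivAt.comp_hasDerivAt (x := q.1.2) (f := fun τ : ℝ => ((q.1.1, τ), q.2)) hl
  have h2 : DifferentiableAt ℝ (fun τ : ℝ => f q.1.1 τ q.2) q.1.2 := by
    exact (Complex.reCLM.hasFDerivAt.comp_hasDerivAt _ h1).differentiableAt
  exact h2.hasDerivAt.ofReal_comp.unique h1

variable {φ : ℝ → ℝ → (Fin n → ℂ) → ℝ} {Φ : smoothGerm q₀}

theorem complexHessian (h : FamilyGerm q₀ φ Φ) (α β : Fin n) :
    HasGerm q₀ (fun q => complexHessian (φ q.1.1 q.1.2) q.2 α β) (hessianGerm Φ α β) :=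
  HasGerm.wirtinger (f := fun t s z => _root_.dzBar β (φ t s) z) (h.dzBar β) α

/-- The complex Hessian of a real function is Hermitian at every point near `q₀`, not only where it is
assumed to be positive definite: `∂` and `∂̄` commute on smooth germs. -/
theorem eventually_isHermitian (h : FamilyGerm q₀ φ Φ) :
    ∀ᶠ q in 𝓝 q₀, (_root_.complexHessian (φ q.1.1 q.1.2) q.2).IsHermitian := by
  have key : ∀ α β, ∀ᶠ q in 𝓝 q₀,
      wirtinger α (_root_.dzBar β (φ q.1.1 q.1.2)) q.2 =
        wirtingerBar β (_root_.dz α (φ q.1.1 q.1.2)) q.2 := by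
    intro α β
    have h1 := HasGerm.wirtinger (f := fun t s z => _root_.dzBar β (φ t s) z) (h.dzBar β) α
    have h2 := HasGerm.wirtingerBar (f := fun t s z => _root_.dz α (φ t s) z) (h.dz α) β
    rw [holDerivation_barDerivation] at h1
    exact h1.eventuallyEq h2
  filter_upwards [eventually_all.2 fun α => eventually_all.2 (key α)] with q hq
  ext α β
  change star (wirtinger β (_root_.dzBar α (φ q.1.1 q.1.2)) q.2) =
    wirtinger α (_root_.dzBar β (φ q.1.1 q.1.2)) q.2
  rw [star_wirtinger, hq α β]
  simp only [star_dzBar]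

theorem exists_inverseHessian (h : FamilyGerm q₀ φ Φ)
    (h0 : (_root_.complexHessian (φ q₀.1.1 q₀.1.2) q₀.2).det ≠ 0) :
    ∃ A : Matrix (Fin n) (Fin n) (smoothGerm q₀),
      (∀ α β, HasGerm q₀ (fun q => inverseHessian (φ q.1.1 q.1.2) q.2 α β) (A α β)) ∧
      (hessianGerm Φ).transpose * A = 1 := by
  have hM : ∀ i j, HasGerm q₀
      (fun q => (_root_.complexHessian (φ q.1.1 q.1.2) q.2).transpose i j)
      ((hessianGerm Φ).transpose i j) := by
    intro i j
    simp only [Matrix.transpose_apply]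
    exact h.complexHessian j i
  rw [← Matrix.det_transpose] at h0
  exact HasGerm.exists_matrix_inv hM h0

variable {A : Matrix (Fin n) (Fin n) (smoothGerm q₀)} {f' : ℝ → ℝ → (Fin n → ℂ) → ℝ}
  {g' : smoothGerm q₀}

theorem gradHermitian
    (hA : ∀ α β, HasGerm q₀ (fun q => inverseHessian (φ q.1.1 q.1.2) q.2 α β) (A α β))
    (h : FamilyGerm q₀ f g) (h' : FamilyGerm q₀ f' g') :
    HasGerm q₀ (fun q => gradHermitian (φ q.1.1 q.1.2) (f q.1.1 q.1.2) (f' q.1.1 q.1.2) q.2)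
      (gradPairing A (holDerivation q₀) (barDerivation q₀) g g') :=
  HasGerm.sum _ fun α => HasGerm.sum _ fun β => (hA α β).mul ((h.dz α).mul (h'.dzBar β))

theorem gradInner (hφ : FamilyGerm q₀ φ Φ)
    (hA : ∀ α β, HasGerm q₀ (fun q => inverseHessian (φ q.1.1 q.1.2) q.2 α β) (A α β))
    (h : FamilyGerm q₀ f g) (h' : FamilyGerm q₀ f' g') :
    FamilyGerm q₀ (fun t s => gradInner (φ t s) (f t s) (f' t s))
      (algebraMap ℂ _ (1 / 2) * (gradPairing A (holDerivation q₀) (barDerivation q₀) g g' +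
        gradPairing A (holDerivation q₀) (barDerivation q₀) g' g)) := by
  refine ((HasGerm.const _).mul ((gradHermitian hA h h').add (gradHermitian hA h' h))).congr ?_
  filter_upwards [hφ.eventually_isHermitian] with q hq
  exact ofReal_gradInner hq _ _

theorem poissonBracket (hφ : FamilyGerm q₀ φ Φ)
    (hA : ∀ α β, HasGerm q₀ (fun q => inverseHessian (φ q.1.1 q.1.2) q.2 α β) (A α β))
    (h : FamilyGerm q₀ f g) (h' : FamilyGerm q₀ f' g') :
    FamilyGerm q₀ (fun t s => poissonBracket (φ t s) (f t s) (f' t s))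
      (formalBracket A (holDerivation q₀) (barDerivation q₀) g g') := by
  refine ((HasGerm.const _).mul ((gradHermitian hA h' h).sub (gradHermitian hA h h'))).congr ?_
  filter_upwards [hφ.eventually_isHermitian] with q hq
  exact ofReal_poissonBracket hq _ _

theorem sub (h : FamilyGerm q₀ f g) (h' : FamilyGerm q₀ f' g') :
    FamilyGerm q₀ (fun t s z => f t s z - f' t s z) (g - g') :=
  (HasGerm.sub h h').congr (Eventually.of_forall fun _ => Complex.ofReal_sub _ _)

theorem mul (h : FamilyGerm q₀ f g) (h' : FamilyGerm q₀ f' g') :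
    FamilyGerm q₀ (fun t s z => f t s z * f' t s z) (g * g') :=
  (HasGerm.mul h h').congr (Eventually.of_forall fun _ => Complex.ofReal_mul _ _)

theorem neg (h : FamilyGerm q₀ f g) : FamilyGerm q₀ (fun t s z => - f t s z) (-g) :=
  (HasGerm.neg h).congr (Eventually.of_forall fun _ => Complex.ofReal_neg _)

theorem eq_at (h : FamilyGerm q₀ f g) (h' : FamilyGerm q₀ f' g) :
    f q₀.1.1 q₀.1.2 q₀.2 = f' q₀.1.1 q₀.1.2 q₀.2 :=
  Complex.ofReal_injective (HasGerm.eventuallyEq h h').self_of_nhds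

theorem covDerivT (hφ : FamilyGerm q₀ φ Φ)
    (hA : ∀ α β, HasGerm q₀ (fun q => inverseHessian (φ q.1.1 q.1.2) q.2 α β) (A α β))
    (h : FamilyGerm q₀ f g) :
    FamilyGerm q₀ (covDerivT φ f) (covDerivation A (holDerivation q₀) (barDerivation q₀)
      (dirDerivation q₀ ((1, 0), 0)) (dirDerivation q₀ ((1, 0), 0) Φ) g) := by
  rw [covDerivation_apply, ← gradPairing_eq_sum_raise, ← gradPairing_eq_sum_raise_transpose]
  exact h.partialT.sub (hφ.gradInner hA h hφ.partialT)

theorem covDerivS (hφ : FamilyGerm q₀ φ Φ)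
    (hA : ∀ α β, HasGerm q₀ (fun q => inverseHessian (φ q.1.1 q.1.2) q.2 α β) (A α β))
    (h : FamilyGerm q₀ f g) :
    FamilyGerm q₀ (covDerivS φ f) (covDerivation A (holDerivation q₀) (barDerivation q₀)
      (dirDerivation q₀ ((0, 1), 0)) (dirDerivation q₀ ((0, 1), 0) Φ) g) := by
  rw [covDerivation_apply, ← gradPairing_eq_sum_raise, ← gradPairing_eq_sum_raise_transpose]
  exact h.partialS.sub (hφ.gradInner hA h hφ.partialS)

/-- The curvature formula at a point, read off from the identity `covDerivation_comm` of germs. -/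
theorem mabuchiCurvature_eq (hφ : FamilyGerm q₀ φ Φ)
    (h0 : (_root_.complexHessian (φ q₀.1.1 q₀.1.2) q₀.2).det ≠ 0)
    (h : FamilyGerm q₀ f g) :
    mabuchiCurvature φ f q₀.1.1 q₀.1.2 q₀.2 =
      -_root_.poissonBracket (φ q₀.1.1 q₀.1.2)
        (_root_.poissonBracket (φ q₀.1.1 q₀.1.2) (_root_.partialT φ q₀.1.1 q₀.1.2)
          (_root_.partialS φ q₀.1.1 q₀.1.2)) (f q₀.1.1 q₀.1.2) q₀.2 := by
  obtain ⟨A, hA, hHA⟩ := hφ.exists_inverseHessian h0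
  have h1 := (hφ.covDerivS hA (hφ.covDerivT hA h)).sub (hφ.covDerivT hA (hφ.covDerivS hA h))
  rw [covDerivation_comm hHA (fun _ _ => rfl) holDerivation_comm barDerivation_comm
    holDerivation_barDerivation (dirDerivation_holDerivation _) (dirDerivation_barDerivation _)
    (dirDerivation_holDerivation _) (dirDerivation_barDerivation _)
    (dirDerivation_comm _ _ _)] at h1
  exact h1.eq_at (hφ.poissonBracket hA (hφ.poissonBracket hA hφ.partialT hφ.partialS) h).neg

end FamilyGerm

end Families

/-! ### The Poisson formalBracket as a divergence, and the sectional curvature -/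

section Slices

variable {n : ℕ}

theorem HasGerm.contDiffAt_slice {t s : ℝ} {z : Fin n → ℂ} {F : (ℝ × ℝ) × (Fin n → ℂ) → ℂ}
    {g : smoothGerm ((t, s), z)} (h : HasGerm ((t, s), z) F g) :
    ContDiffAt ℝ ∞ (fun w => F ((t, s), w)) z :=
  h.contDiffAt.comp z (contDiffAt_const.prodMk contDiffAt_id)

theorem HasGerm.continuousWithinAt_slice {t s : ℝ} {z : Fin n → ℂ} {S : Set (Fin n → ℂ)}
    {F : (ℝ × ℝ) × (Fin n → ℂ) → ℂ}
    {g : smoothGerm ((t, s), z)} (h : HasGerm ((t, s), z) F g) :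
    ContinuousWithinAt (fun w => F ((t, s), w)) S z :=
  h.contDiffAt_slice.continuousAt.continuousWithinAt

theorem FamilyGerm.continuousWithinAt_slice {t s : ℝ} {z : Fin n → ℂ} {S : Set (Fin n → ℂ)}
    {f : ℝ → ℝ → (Fin n → ℂ) → ℝ} {g : smoothGerm ((t, s), z)} (h : FamilyGerm ((t, s), z) f g) :
    ContinuousWithinAt (f t s) S z :=
  Complex.continuous_re.continuousAt.comp_continuousWithinAt
    (HasGerm.continuousWithinAt_slice (S := S) h)

end Slices

section Divergence

variable {n : ℕ}

/-- The `(1,0)` gradient field `u^α = ∑_β φ^{αβ̄} u_β̄`. -/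
def gradHol (φ u : (Fin n → ℂ) → ℝ) (α : Fin n) (z : Fin n → ℂ) : ℂ :=
  ∑ β, inverseHessian φ z α β * dzBar β u z

/-- The `(0,1)` gradient field `u^β̄ = ∑_α φ^{αβ̄} u_α`. -/
def gradBar (φ u : (Fin n → ℂ) → ℝ) (β : Fin n) (z : Fin n → ℂ) : ℂ :=
  ∑ α, inverseHessian φ z α β * dz α u z

variable {q₀ : (ℝ × ℝ) × (Fin n → ℂ)} {φ f u : ℝ → ℝ → (Fin n → ℂ) → ℝ}
  {Φ F V : smoothGerm q₀} {A : Matrix (Fin n) (Fin n) (smoothGerm q₀)}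

theorem FamilyGerm.det_mul_gradHol_mul (hφ : FamilyGerm q₀ φ Φ)
    (hA : ∀ α β, HasGerm q₀ (fun q => inverseHessian (φ q.1.1 q.1.2) q.2 α β) (A α β))
    (hf : FamilyGerm q₀ f F) (hu : FamilyGerm q₀ u V) (α : Fin n) :
    HasGerm q₀ (fun q => (_root_.complexHessian (φ q.1.1 q.1.2) q.2).det *
        gradHol (φ q.1.1 q.1.2) (u q.1.1 q.1.2) α q.2 * f q.1.1 q.1.2 q.2)
      ((hessianGerm Φ).det * raiseIndex A (barDerivation q₀) V α * F) :=
  ((HasGerm.det hφ.complexHessian).mul (HasGerm.sum _ fun β => (hA α β).mul (hu.dzBar β))).mul hf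

theorem FamilyGerm.det_mul_gradBar_mul (hφ : FamilyGerm q₀ φ Φ)
    (hA : ∀ α β, HasGerm q₀ (fun q => inverseHessian (φ q.1.1 q.1.2) q.2 α β) (A α β))
    (hf : FamilyGerm q₀ f F) (hu : FamilyGerm q₀ u V) (β : Fin n) :
    HasGerm q₀ (fun q => (_root_.complexHessian (φ q.1.1 q.1.2) q.2).det *
        gradBar (φ q.1.1 q.1.2) (u q.1.1 q.1.2) β q.2 * f q.1.1 q.1.2 q.2)
      ((hessianGerm Φ).det * raiseIndex A.transpose (holDerivation q₀) V β * F) :=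
  ((HasGerm.det hφ.complexHessian).mul (HasGerm.sum _ fun α => (hA α β).mul (hu.dz α))).mul hf

/-- `det_mul_formalBracket` for functions. -/
theorem FamilyGerm.det_mul_poissonBracket (hφ : FamilyGerm q₀ φ Φ)
    (h0 : (_root_.complexHessian (φ q₀.1.1 q₀.1.2) q₀.2).det ≠ 0)
    (hf : FamilyGerm q₀ f F) (hu : FamilyGerm q₀ u V) :
    (_root_.complexHessian (φ q₀.1.1 q₀.1.2) q₀.2).det *
        (_root_.poissonBracket (φ q₀.1.1 q₀.1.2) (f q₀.1.1 q₀.1.2) (u q₀.1.1 q₀.1.2) q₀.2 : ℂ) =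
      Complex.I / 2 *
        (∑ β, wirtingerBar β (fun z => (_root_.complexHessian (φ q₀.1.1 q₀.1.2) z).det *
            gradBar (φ q₀.1.1 q₀.1.2) (u q₀.1.1 q₀.1.2) β z * f q₀.1.1 q₀.1.2 z) q₀.2 -
          ∑ α, wirtinger α (fun z => (_root_.complexHessian (φ q₀.1.1 q₀.1.2) z).det *
            gradHol (φ q₀.1.1 q₀.1.2) (u q₀.1.1 q₀.1.2) α z * f q₀.1.1 q₀.1.2 z) q₀.2) := by
  obtain ⟨A, hA, hHA⟩ := hφ.exists_inverseHessian h0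
  have h1 := (HasGerm.det hφ.complexHessian).mul (hφ.poissonBracket hA hf hu)
  rw [det_mul_formalBracket hHA (fun _ _ => rfl) holDerivation_comm barDerivation_comm
    holDerivation_barDerivation] at h1
  have h2 := (HasGerm.const (Complex.I / 2)).mul
    ((HasGerm.sum Finset.univ fun β => HasGerm.wirtingerBar
      (f := fun t s z => (_root_.complexHessian (φ t s) z).det *
        gradBar (φ t s) (u t s) β z * f t s z) (hφ.det_mul_gradBar_mul hA hf hu β) β).sub
    (HasGerm.sum Finset.univ fun α => HasGerm.wirtinger
      (f := fun t s z => (_root_.complexHessian (φ t s) z).det *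
        gradHol (φ t s) (u t s) α z * f t s z) (hφ.det_mul_gradHol_mul hA hf hu α) α))
  exact (h1.eventuallyEq h2).self_of_nhds

theorem ofReal_det_complexHessian {φ : (Fin n → ℂ) → ℝ} {z : Fin n → ℂ}
    (h : (complexHessian φ z).PosDef) :
    0 < (complexHessian φ z).det.re ∧
      ((complexHessian φ z).det.re : ℂ) = (complexHessian φ z).det := by
  have := Complex.lt_def.1 h.det_pos
  exact ⟨this.1, Complex.ext rfl this.2⟩

/-- The flow of a Hamiltonian field preserves the Monge-Ampère measure: the bracket `{f, u}_φ` has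
integral zero if `f` vanishes on the boundary. -/
theorem integral_poissonBracket_mul_mongeAmpereDensity {Ω : Set (Fin n → ℂ)}
    (hΩ : IsSmoothStrictlyPseudoconvexDomain Ω) {t s : ℝ}
    (hφ : ∀ z ∈ closure Ω, ∃ Φ, FamilyGerm ((t, s), z) φ Φ)
    (hpos : ∀ z ∈ closure Ω, (complexHessian (φ t s) z).PosDef)
    (hf : ∀ z ∈ closure Ω, ∃ F, FamilyGerm ((t, s), z) f F)
    (hu : ∀ z ∈ closure Ω, ∃ V, FamilyGerm ((t, s), z) u V)
    (hf0 : ∀ z ∈ frontier Ω, f t s z = 0) :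
    ∫ z in Ω, poissonBracket (φ t s) (f t s) (u t s) z * mongeAmpereDensity (φ t s) z = 0 := by
  have hdet : ∀ z ∈ closure Ω, (complexHessian (φ t s) z).det ≠ 0 := fun z hz =>
    (hpos z hz).det_pos.ne'
  set X : Fin n → (Fin n → ℂ) → ℂ := fun α z =>
    (complexHessian (φ t s) z).det * gradHol (φ t s) (u t s) α z * f t s z with hX
  set Y : Fin n → (Fin n → ℂ) → ℂ := fun β z =>
    (complexHessian (φ t s) z).det * gradBar (φ t s) (u t s) β z * f t s z with hY
  have hXs : ∀ α, ∀ z ∈ closure Ω, ContDiffAt ℝ 1 (X α) z := by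
    intro α z hz
    obtain ⟨Φ, hΦ⟩ := hφ z hz
    obtain ⟨F, hF⟩ := hf z hz
    obtain ⟨V, hV⟩ := hu z hz
    obtain ⟨A, hA, -⟩ := hΦ.exists_inverseHessian (hdet z hz)
    exact (hΦ.det_mul_gradHol_mul hA hF hV α).contDiffAt_slice.of_le (by simp)
  have hYs : ∀ α, ∀ z ∈ closure Ω, ContDiffAt ℝ 1 (Y α) z := by
    intro α z hz
    obtain ⟨Φ, hΦ⟩ := hφ z hz
    obtain ⟨F, hF⟩ := hf z hz
    obtain ⟨V, hV⟩ := hu z hz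
    obtain ⟨A, hA, -⟩ := hΦ.exists_inverseHessian (hdet z hz)
    exact (hΦ.det_mul_gradBar_mul hA hF hV α).contDiffAt_slice.of_le (by simp)
  have hdiv : ∫ z in Ω, Complex.I / 2 *
      (∑ β, wirtingerBar β (Y β) z - ∑ α, wirtinger α (X α) z) = 0 := by
    have iX := fun α => (integrableOn_wirtinger hΩ.isBounded (hXs α) α).1
    have iY := fun β => (integrableOn_wirtinger hΩ.isBounded (hYs β) β).2
    rw [MeasureTheory.integral_const_mul, MeasureTheory.integral_sub
      (MeasureTheory.integrable_finsetSum _ fun β _ => iY β)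
      (MeasureTheory.integrable_finsetSum _ fun α _ => iX α),
      MeasureTheory.integral_finsetSum _ fun β _ => iY β,
      MeasureTheory.integral_finsetSum _ fun α _ => iX α]
    have zX := fun α => (integral_wirtinger_eq_zero hΩ (hXs α)
      (fun z hz => by simp [hX, hf0 z hz]) α).1
    have zY := fun β => (integral_wirtinger_eq_zero hΩ (hYs β)
      (fun z hz => by simp [hY, hf0 z hz]) β).2
    simp only [zX, zY, Finset.sum_const_zero, sub_zero, mul_zero]
  have hre : ∫ z in Ω, poissonBracket (φ t s) (f t s) (u t s) z *
      (complexHessian (φ t s) z).det.re = 0 := by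
    apply Complex.ofReal_injective
    rw [← integral_complex_ofReal, Complex.ofReal_zero, ← hdiv]
    refine MeasureTheory.setIntegral_congr_fun hΩ.isOpen.measurableSet fun z hz => ?_
    have hzc := subset_closure hz
    obtain ⟨Φ, hΦ⟩ := hφ z hzc
    obtain ⟨F, hF⟩ := hf z hzc
    obtain ⟨V, hV⟩ := hu z hzc
    have := hΦ.det_mul_poissonBracket (hdet z hzc) hF hV
    simp only [Complex.ofReal_mul, (ofReal_det_complexHessian (hpos z hzc)).2]
    rw [mul_comm]
    exact this
  simp only [mongeAmpereDensity, mul_left_comm _ ((n.factorial : ℝ) * (2 / Real.pi) ^ n)]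
  rw [MeasureTheory.integral_const_mul, hre, mul_zero]

end Divergence

theorem partialS_eq_zero_of_eq_zero {n : ℕ} {T : Set (ℝ × ℝ)}
    (hT : IsOpen T) {φ : ℝ → ℝ → (Fin n → ℂ) → ℝ} {t s : ℝ} (hts : (t, s) ∈ T)
    {z : Fin n → ℂ} (h0 : ∀ p ∈ T, φ p.1 p.2 z = 0) : partialS φ t s z = 0 := by
  have hc : ContinuousAt (fun τ : ℝ => (t, τ)) s := by fun_prop
  have : (fun τ => φ t τ z) =ᶠ[𝓝 s] fun _ => 0 :=
    (hc.eventually (hT.mem_nhds hts)).mono fun τ hτ => h0 _ hτ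
  exact this.deriv_eq.trans (deriv_const _ _)

theorem mongeAmpereDensity_nonneg {n : ℕ} {φ : (Fin n → ℂ) → ℝ} {z : Fin n → ℂ}
    (h : (complexHessian φ z).PosDef) : 0 ≤ mongeAmpereDensity φ z := by
  have := (ofReal_det_complexHessian h).1.le
  rw [mongeAmpereDensity]
  positivity

/-- Writing `w = {φ_t, φ_s}`, the Leibniz rule gives `{w φ_s, φ_t} = φ_s {w, φ_t} - w²`, and the left
side has integral zero because `φ_s` vanishes on the boundary. -/
theorem mabuchiSectional_eq {n : ℕ} {Ω : Set (Fin n → ℂ)}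
    (hΩ : IsSmoothStrictlyPseudoconvexDomain Ω)
    {T : Set (ℝ × ℝ)} (hT : IsOpen T) {φ : ℝ → ℝ → (Fin n → ℂ) → ℝ}
    (hφ : IsSmoothFamily Ω T φ) (hφH : ∀ p ∈ T, φ p.1 p.2 ∈ mabuchiSpace Ω) {t s : ℝ}
    (hts : (t, s) ∈ T) :
    mabuchiSectional Ω φ t s =
      -(mabuchiNorm Ω (φ t s) (poissonBracket (φ t s) (partialT φ t s) (partialS φ t s))) ^ 2 := by
  have hg : ∀ z ∈ closure Ω, ∃ Φ, FamilyGerm ((t, s), z) φ Φ := fun z hz =>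
    hφ.exists_familyGerm ⟨hts, hz⟩
  have hpos : ∀ z ∈ closure Ω, (complexHessian (φ t s) z).PosDef := (hφH _ hts).2.1
  set W : ℝ → ℝ → (Fin n → ℂ) → ℝ := fun t s =>
    poissonBracket (φ t s) (partialT φ t s) (partialS φ t s) with hW
  have hWg : ∀ z ∈ closure Ω, ∃ g, FamilyGerm ((t, s), z) W g := by
    intro z hz
    obtain ⟨Φ, hΦ⟩ := hg z hz
    obtain ⟨A, hA, -⟩ := hΦ.exists_inverseHessian (hpos z hz).det_pos.ne'
    exact ⟨_, hΦ.poissonBracket hA hΦ.partialT hΦ.partialS⟩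
  have hS : ∀ z ∈ closure Ω, ∃ g, FamilyGerm ((t, s), z) (partialS φ) g := fun z hz =>
    (hg z hz).elim fun _ h => ⟨_, h.partialS⟩
  have hTg : ∀ z ∈ closure Ω, ∃ g, FamilyGerm ((t, s), z) (partialT φ) g := fun z hz =>
    (hg z hz).elim fun _ h => ⟨_, h.partialT⟩
  set WS : ℝ → ℝ → (Fin n → ℂ) → ℝ := fun t s z => W t s z * partialS φ t s z with hWS
  have hWSg : ∀ z ∈ closure Ω, ∃ g, FamilyGerm ((t, s), z) WS g := by
    intro z hz
    obtain ⟨g, h⟩ := hWg z hz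
    obtain ⟨g', h'⟩ := hS z hz
    exact ⟨_, h.mul h'⟩
  have hzero := integral_poissonBracket_mul_mongeAmpereDensity hΩ hg hpos hWSg hTg
    (fun z hz => by
      rw [hWS]
      simp only
      rw [partialS_eq_zero_of_eq_zero hT hts fun p hp => (hφH p hp).2.2 z hz, mul_zero])
  have hρ : ContinuousOn (mongeAmpereDensity (φ t s)) (closure Ω) := by
    intro z hz
    obtain ⟨Φ, hΦ⟩ := hg z hz
    exact continuousWithinAt_const.mul (Complex.continuous_re.continuousAt.comp_continuousWithinAt
      (HasGerm.det hΦ.complexHessian).continuousWithinAt_slice)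
  have hWc : ContinuousOn (W t s) (closure Ω) := fun z hz =>
    (hWg z hz).elim fun _ h => h.continuousWithinAt_slice
  have hPc : ContinuousOn (poissonBracket (φ t s) (WS t s) (partialT φ t s)) (closure Ω) := by
    intro z hz
    obtain ⟨Φ, hΦ⟩ := hg z hz
    obtain ⟨A, hA, -⟩ := hΦ.exists_inverseHessian (hpos z hz).det_pos.ne'
    obtain ⟨g, h⟩ := hWSg z hz
    exact (hΦ.poissonBracket hA h hΦ.partialT).continuousWithinAt_slice
  have hnorm : (mabuchiNorm Ω (φ t s) (W t s)) ^ 2 = mabuchiInner Ω (φ t s) (W t s) (W t s) := by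
    refine Real.sq_sqrt (MeasureTheory.setIntegral_nonneg hΩ.isOpen.measurableSet fun z hz => ?_)
    exact mul_nonneg (mul_self_nonneg _) (mongeAmpereDensity_nonneg (hpos z (subset_closure hz)))
  rw [hnorm, mabuchiSectional, mabuchiInner, mabuchiInner]
  have hpt : ∀ z ∈ Ω, mabuchiCurvature φ (partialT φ) t s z * partialS φ t s z *
      mongeAmpereDensity (φ t s) z =
      -(poissonBracket (φ t s) (WS t s) (partialT φ t s) z * mongeAmpereDensity (φ t s) z +
        W t s z * W t s z * mongeAmpereDensity (φ t s) z) := by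
    intro z hz
    have hzc := subset_closure hz
    obtain ⟨Φ, hΦ⟩ := hg z hzc
    have hdet := (hpos z hzc).det_pos.ne'
    obtain ⟨A, hA, -⟩ := hΦ.exists_inverseHessian hdet
    have hw := hΦ.poissonBracket hA hΦ.partialT hΦ.partialS
    have h1 := hΦ.poissonBracket hA (hw.mul hΦ.partialS) hΦ.partialT
    rw [formalBracket_mul_left, formalBracket_antisymm _ _ _ (dirDerivation _ ((0, 1), 0) Φ),
      mul_neg, neg_add_eq_sub] at h1
    have h2 := h1.eq_at ((hΦ.partialS.mul (hΦ.poissonBracket hA hw hΦ.partialT)).sub (hw.mul hw))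
    have h3 := hΦ.mabuchiCurvature_eq hdet hΦ.partialT
    simp only at h2 h3
    simp only [hWS, hW]
    rw [h3, h2]
    ring
  rw [MeasureTheory.setIntegral_congr_fun hΩ.isOpen.measurableSet hpt,
    MeasureTheory.integral_neg, MeasureTheory.integral_add, hzero, zero_add]
  · exact ContinuousOn.integrableOn_of_isBounded hΩ.isBounded (hPc.mul hρ)
  · exact ContinuousOn.integrableOn_of_isBounded hΩ.isBounded ((hWc.mul hWc).mul hρ)

theorem theorem1p15 {n : ℕ} (Ω : Set (Fin n → ℂ)) (hΩ : IsSmoothStrictlyPseudoconvexDomain Ω)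
    (T : Set (ℝ × ℝ)) (hT : IsOpen T) (φ : ℝ → ℝ → (Fin n → ℂ) → ℝ)
    (hφ : IsSmoothFamily Ω T φ) (hφH : ∀ p ∈ T, φ p.1 p.2 ∈ mabuchiSpace Ω) :
    (∀ ψ : ℝ → ℝ → (Fin n → ℂ) → ℝ, IsSmoothFamily Ω T ψ →
      (∀ p ∈ T, ψ p.1 p.2 ∈ mabuchiTangent Ω) →
      ∀ t s : ℝ, (t, s) ∈ T → ∀ z ∈ closure Ω,
        mabuchiCurvature φ ψ t s z =
          -poissonBracket (φ t s)
            (poissonBracket (φ t s) (partialT φ t s) (partialS φ t s)) (ψ t s) z) ∧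
    (∀ t s : ℝ, (t, s) ∈ T →
      mabuchiSectional Ω φ t s =
        -(mabuchiNorm Ω (φ t s)
          (poissonBracket (φ t s) (partialT φ t s) (partialS φ t s))) ^ 2 ∧
      mabuchiSectional Ω φ t s ≤ 0) := by
  refine ⟨fun ψ hψ _ t s hts z hz => ?_, fun t s hts => ?_⟩
  · obtain ⟨Φ, hΦ⟩ := hφ.exists_familyGerm (q₀ := ((t, s), z)) ⟨hts, hz⟩
    obtain ⟨Ψ, hΨ⟩ := hψ.exists_familyGerm (q₀ := ((t, s), z)) ⟨hts, hz⟩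
    exact hΦ.mabuchiCurvature_eq ((hφH _ hts).2.1 z hz).det_pos.ne' hΨ
  · have h := mabuchiSectional_eq hΩ hT hφ hφH hts
    exact ⟨h, h ▸ neg_nonpos.2 (sq_nonneg _)⟩

end
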